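/- **Setting.** Participants $i=1,2,\dots$ have covariates $X_i\in\mathcal X$, an observed binary treatment $W_i$, and potential submissions $B_i(1),B_i(0)\in\mathcal B$; the tuples $(X_i,B_i(1),B_i(0),W_i)$ are i.i.d. A treatment vector $\mathbf w\in\{0,1\}^n$ leads to the submissions $\mathbf B(\mathbf w)=(B_i(w_i))_{i\le n}$, a mechanism computes from them a vector of cutoffs $P_n(\mathbf w)\in\mathcal S\subseteq\mathbb R^J$ ($J\ge 1$ fixed), and participant $i$ obtains the allocation $D_i(\mathbf w)=d(B_i(w_i),P_n(\mathbf w))\in\mathbb R^J$ and the outcome $Y_i(\mathbf w)=y(B_i(w_i),P_n(\mathbf w))\in\mathbb R$, with known functions $d,y$. Norms are Euclidean. $\Pi$ is a class of measurable rules $\pi:\mathcal X\to[0,1]$ containing $\pi_1\equiv 1$ and $\pi_0\equiv 0$. Under $\pi$ the treatments are drawn as independent $W_i\sim\mathrm{Bernoulli}(\pi(X_i))$, and $\mathbb E_\pi$ is the expectation over these draws, holding $(X_i,B_i(1),B_i(0))_{i\le n}$ fixed. The capacities are $s^*\in[0,1]^J$. Put $$\bar V_n(\pi)=\mathbb E_\pi\Big[\tfrac1n\sum_{i=1}^n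 Y_i(\mathbf W)\Big],\qquad \bar\tau_{\mathrm{GTE}}=\tfrac1n\sum_{i=1}^n\big[Y_i(\mathbf 1_n)-Y_i(\mathbf 0_n)\big],$$ $$y_\pi(p)=\mathbb E[\pi(X_i)y(B_i(1),p)+(1-\pi(X_i))y(B_i(0),p)],\quad z_\pi(p)=\mathbb E[\pi(X_i)d(B_i(1),p)+(1-\pi(X_i))d(B_i(0),p)]-s^*.$$ **Assumptions.** There are constants $c_1,c_2,c_3,c_4,c',c>0$ such that the following hold. 1. *Identification.* $\{B_i(1),B_i(0)\}\perp W_i\mid X_i$, and $e(x)=P(W_i=1\mid X_i=x)$ satisfies $0<e(x)<1$ for all $x$. 2. *Cutoff mechanism.* Allocations $d(b,p)$ are bounded uniformly over $b\in\mathcal B$, $p\in\mathcal S$. There is a sequence $a_n$ with $\sqrt n\,a_n\to0$ such that, with $\mathcal C_{\mathbf w}=\{p\in\mathbb R^J:\|\frac1n\sum_{i\le n} d(B_i(w_i),p)-s^*\|\le a_n\}$: for every $\pi\in\Pi$ and $n\ge1$, when $\mathbf W$ is drawn from $\pi$, the set $\mathcal C_{\mathbf W}$ is non-empty with probability at least $1-e^{-cn}$;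 and, for every $\mathbf w$, almost surely $P_n(\mathbf w)\in\mathcal C_{\mathbf w}$ whenever $\mathcal C_{\mathbf w}\ne\emptyset$. 3. *Regularity of outcomes.* (i) For some $h_d,h_y,C>0$, the classes $\{b\mapsto d_j(b,p):p\in\mathcal S\}$, $j\le J$, and $\{b\mapsto y(b,p):p\in\mathcal S\}$ have $L_2(Q)$ $\epsilon$-covering numbers at most $C(1/\epsilon)^{h_d}$ and $C(1/\epsilon)^{h_y}$ respectively, for all $0<\epsilon<1$, uniformly over finitely discrete probability measures $Q$. (ii) $y$ is uniformly bounded on $\mathcal B\times\mathcal S$, and for some $L>0$, all $w\in\{0,1\}$, $j\le J$ and $p,p'\in\mathcal S$, $\mathbb E[(d_j(B_i(w),p)-d_j(B_i(w),p'))^2]\le L\|p-p'\|$ and $\mathbb E[(y(B_i(w),p)-y(B_i(w),p'))^2]\le L\|p-p'\|$. (iii) For all $w$ and $x$, (versions of) $\mathbb E[d(B_i(w),p)\mid X_i=x]$ and $\mathbb E[y(B_i(w),p)\mid X_i=x]$ are twice continuously differentiable in $p$ on the interior of $\mathcal S$, with first and second partial derivatives bounded by $c'$. (iv) For every $\pi\in\Pi$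 the singular values of the Jacobian $\nabla_p z_\pi(p^*_\pi)$ lie in $[c_3,c_4]$. 4. *Regularity of equilibrium.* $\mathcal S$ is compact. For every $\pi\in\Pi$, $p^*_\pi$ is the unique $p\in\mathcal S$ with $z_\pi(p)=0$, $\mathcal S$ contains the ball of radius $c_1$ centered at $p^*_\pi$, and $2\|z_\pi(p)\|\ge c_2$ for all $p\in\mathcal S$ with $\|p-p^*_\pi\|\ge c_3/(2Jc')$. Write $p^*_w=p^*_{\pi_w}$ for $w\in\{0,1\}$, and let $$V^*(\pi)=y_\pi(p^*_\pi),\qquad \tau^*_{\mathrm{GTE}}=\mathbb E[y(B_i(1),p^*_1)]-\mathbb E[y(B_i(0),p^*_0)],$$ $$\nu^*_w=\nabla_p^\top\mathbb E[y(B_i(w),p^*_w)]\,\big(\nabla_p\mathbb E[d(B_i(w),p^*_w)]\big)^{-1},\qquad q_w(b,p)=y(b,p)-\nu^*_w\,(d(b,p)-s^*).$$ **Theorem.** Under these assumptions, $\sqrt n\,(\bar V_n(\pi)-V^*(\pi))=O_p(1)$ for every $\pi\in\Pi$, and $$\bar\tau_{\mathrm{GTE}}-\tau^*_{\mathrm{GTE}}=\frac1n\sum_{i=1}^n\Big(q_1(B_i(1),p^*_1)-q_0(B_i(0),p^*_0)\Big)-\tau^*_{\mathrm{GTE}}+o_p(n^{-1/2}).$$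 -/

import Mathlib

open MeasureTheory ProbabilityTheory Filter Topology

noncomputable section

namespace CutoffMarket

/-- Cutoffs, allocations and capacities live in `ℝ^J` with its Euclidean norm. -/
abbrev RJ (J : ℕ) : Type := EuclideanSpace ℝ (Fin J)

/-! ### Stochastic order symbols -/

/-- `T n = O_p(1)`. -/
def BoundedInProbability {Ω : Type*} [MeasurableSpace Ω] (μ : Measure Ω)
    (T : ℕ → Ω → ℝ) : Prop :=
  ∀ ε : ℝ, 0 < ε → ∃ K : ℝ, ∀ᶠ n in atTop, μ {ω | K < |T n ω|} ≤ ENNReal.ofReal ε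

/-- `T n = o_p(r n)` for a sequence `r` of rates that are eventually positive. -/
def LittleOInProbability {Ω : Type*} [MeasurableSpace Ω] (μ : Measure Ω)
    (T : ℕ → Ω → ℝ) (r : ℕ → ℝ) : Prop :=
  TendstoInMeasure μ (fun n ω => T n ω / r n) atTop (fun _ => 0)

/-! ### Uniform covering numbers -/

/-- The `L₂(Q)` distance of two functions, where `Q = ∑ i, wt i • δ_(pt i)`. -/
def l2Dist {𝓑 : Type*} {k : ℕ} (pt : Fin k → 𝓑) (wt : Fin k → ℝ) (f g : 𝓑 → ℝ) : ℝ :=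
  Real.sqrt (∑ i, wt i * (f (pt i) - g (pt i)) ^ 2)

/-- `N(ε, F, L₂(Q))`: the least number of open `L₂(Q)`-balls of radius `ε` (with arbitrary
functions as centres) that cover `F`, where `Q = ∑ i, wt i • δ_(pt i)`. -/
def coveringNumber {𝓑 : Type*} {k : ℕ} (pt : Fin k → 𝓑) (wt : Fin k → ℝ) (ε : ℝ)
    (F : Set (𝓑 → ℝ)) : ℕ∞ :=
  ⨅ (G : Finset (𝓑 → ℝ)) (_ : ∀ f ∈ F, ∃ g ∈ G, l2Dist pt wt f g < ε), (G.card : ℕ∞)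

/-- The uniform covering number of `F`, the supremum of `N(ε, F, L₂(Q))` over all finitely
discrete probability measures `Q`, is at most `C (1/ε)^h` for every `0 < ε < 1`. -/
def UniformCoveringBound {𝓑 : Type*} (F : Set (𝓑 → ℝ)) (C h : ℝ) : Prop :=
  ∀ ε : ℝ, 0 < ε → ε < 1 →
    (⨆ (k : ℕ) (pt : Fin k → 𝓑) (wt : Fin k → ℝ) (_ : wt ∈ stdSimplex ℝ (Fin k)),
      (coveringNumber pt wt ε F : ENNReal)) ≤ ENNReal.ofReal (C * (1 / ε) ^ h)

/-! ### Smoothness with bounded derivatives -/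

/-- `f` is twice continuously differentiable on the open set `U`, and all its first and second
partial derivatives there are at most `c` in absolute value. -/
def SmoothBounded {J : ℕ} (f : RJ J → ℝ) (U : Set (RJ J)) (c : ℝ) : Prop :=
  ContDiffOn ℝ 2 f U ∧
    ∀ p ∈ U,
      (∀ j : Fin J, |fderiv ℝ f p (EuclideanSpace.single j 1)| ≤ c) ∧
      (∀ j k : Fin J, |iteratedFDeriv ℝ 2 f p
        ![EuclideanSpace.single j 1, EuclideanSpace.single k 1]| ≤ c)

/-! ### Random treatment assignment -/

/-- Probability that independent `W i ∼ Bernoulli (π (x i))` take the values `w i`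
(`true` is "treated"). -/
def policyWeight {𝓧 : Type*} {n : ℕ} (π : 𝓧 → ℝ) (x : Fin n → 𝓧) (w : Fin n → Bool) : ℝ :=
  ∏ i, if w i then π (x i) else 1 - π (x i)

/-- `E_π[f(W)]`: expectation over the random treatments only, given the covariates `x`. -/
def policyExp {𝓧 : Type*} {n : ℕ} (π : 𝓧 → ℝ) (x : Fin n → 𝓧) (f : (Fin n → Bool) → ℝ) : ℝ :=
  ∑ w : Fin n → Bool, policyWeight π x w * f w

/-- The rule that treats everybody (`w = true`) or nobody (`w = false`). -/
def constRule (𝓧 : Type*) (w : Bool) : 𝓧 → ℝ := fun _ => if w then 1 else 0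

/-! ### The market -/

/-- The data of the model. Participant `i` has covariates `X i`, observed treatment `W i` and
potential submissions `B true i`, `B false i`; a submission depends on the own treatment only.
Allocations and outcomes are known functions `d b p`, `y b p` of the own submission and of the
cutoffs, and `cutoff n` is the mechanism that computes the cutoffs from the `n` submissions. -/
structure Market (Ω 𝓧 𝓑 : Type*) (J : ℕ) where
  X : ℕ → Ω → 𝓧
  W : ℕ → Ω → Bool
  B : Bool → ℕ → Ω → 𝓑
  d : 𝓑 → RJ J → RJ J
  y : 𝓑 → RJ J → ℝ
  /-- fractional capacities `s*` -/
  cap : RJ J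
  /-- the set of cutoffs -/
  S : Set (RJ J)
  cutoff : (n : ℕ) → (Fin n → 𝓑) → RJ J

namespace Market

variable {Ω 𝓧 𝓑 : Type*} {J : ℕ} (M : Market Ω 𝓧 𝓑 J)

/-- The covariates of the first `n` participants. -/
def covariates (n : ℕ) (ω : Ω) : Fin n → 𝓧 := fun i => M.X i ω

/-- The submissions of the first `n` participants under the treatment vector `w`. -/
def bids (n : ℕ) (w : Fin n → Bool) (ω : Ω) : Fin n → 𝓑 := fun i => M.B (w i) i ω

/-- The finite-market cutoffs `P_n(w)`. -/
def P (n : ℕ) (w : Fin n → Bool) (ω : Ω) : RJ J := M.cutoff n (M.bids n w ω)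

/-- The potential allocation `D_i(w)`. -/
def allocation (n : ℕ) (w : Fin n → Bool) (i : Fin n) (ω : Ω) : RJ J :=
  M.d (M.B (w i) i ω) (M.P n w ω)

/-- The potential outcome `Y_i(w)`. -/
def outcome (n : ℕ) (w : Fin n → Bool) (i : Fin n) (ω : Ω) : ℝ :=
  M.y (M.B (w i) i ω) (M.P n w ω)

/-- The set of cutoffs that clear the `n`-participant market up to the error `a`. -/
def clearing (n : ℕ) (a : ℝ) (w : Fin n → Bool) (ω : Ω) : Set (RJ J) :=
  {p | ‖(∑ i : Fin n, (1 / (n : ℝ)) • M.d (M.B (w i) i ω) p) - M.cap‖ ≤ a}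

/-- The finite-market value of the rule `π`. -/
def finiteValue (n : ℕ) (π : 𝓧 → ℝ) (ω : Ω) : ℝ :=
  policyExp π (M.covariates n ω) fun w => (1 / (n : ℝ)) * ∑ i : Fin n, M.outcome n w i ω

/-- The finite-market global treatment effect. -/
def finiteGTE (n : ℕ) (ω : Ω) : ℝ :=
  (1 / (n : ℝ)) * ∑ i : Fin n,
    (M.outcome n (fun _ => true) i ω - M.outcome n (fun _ => false) i ω)

variable [MeasurableSpace Ω] (μ : Measure Ω)

/-- `E[y(B_i(w), p)]`. -/
def meanY (w : Bool) (p : RJ J) : ℝ := ∫ ω, M.y (M.B w 0 ω) p ∂μ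

/-- `E[d(B_i(w), p)]`. -/
def meanD (w : Bool) (p : RJ J) : RJ J := ∫ ω, M.d (M.B w 0 ω) p ∂μ

/-- `y_π(p) = E[π(X_i) y(B_i(1), p) + (1 - π(X_i)) y(B_i(0), p)]`. -/
def popY (π : 𝓧 → ℝ) (p : RJ J) : ℝ :=
  ∫ ω, (π (M.X 0 ω) * M.y (M.B true 0 ω) p
    + (1 - π (M.X 0 ω)) * M.y (M.B false 0 ω) p) ∂μ

/-- `z_π(p) = E[π(X_i) d(B_i(1), p) + (1 - π(X_i)) d(B_i(0), p)] - s*`. -/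
def popZ (π : 𝓧 → ℝ) (p : RJ J) : RJ J :=
  (∫ ω, (π (M.X 0 ω) • M.d (M.B true 0 ω) p
    + (1 - π (M.X 0 ω)) • M.d (M.B false 0 ω) p) ∂μ) - M.cap

/-- `p` is the unique element of `S` that clears the continuum market under the rule `π`. -/
def IsEquilibrium (π : 𝓧 → ℝ) (p : RJ J) : Prop :=
  p ∈ M.S ∧ M.popZ μ π p = 0 ∧ ∀ p' ∈ M.S, M.popZ μ π p' = 0 → p' = p

/-- The continuum-market value of `π` at the continuum cutoffs `pstar`. -/
def continuumValue (pstar : (𝓧 → ℝ) → RJ J) (π : 𝓧 → ℝ) : ℝ := M.popY μ π (pstar π)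

/-- The continuum-market global treatment effect. -/
def continuumGTE (pstar : (𝓧 → ℝ) → RJ J) : ℝ :=
  M.meanY μ true (pstar (constRule 𝓧 true)) - M.meanY μ false (pstar (constRule 𝓧 false))

/-- `ν_w(p) = ∇ᵀE[y(B_i(w), p)] (∇E[d(B_i(w), p)])⁻¹`, a row vector, that is, a linear form. -/
def nu (w : Bool) (p : RJ J) : RJ J →L[ℝ] ℝ :=
  (fderiv ℝ (M.meanY μ w) p).comp (fderiv ℝ (M.meanD μ w) p).inverse

/-- The corrected score `y(b, p) - ν*_w (d(b, p) - s*)`, with `ν*_w` evaluated at `pw`. -/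
def score (w : Bool) (pw : RJ J) (b : 𝓑) (p : RJ J) : ℝ :=
  M.y b p - M.nu μ w pw (M.d b p - M.cap)

/-! ### Assumptions -/

variable [MeasurableSpace 𝓧] [MeasurableSpace 𝓑]

/-- The participants are drawn i.i.d. from a population; everything is measurable. -/
structure Sampling : Prop where
  measurable_X : ∀ i, Measurable (M.X i)
  measurable_W : ∀ i, Measurable (M.W i)
  measurable_B : ∀ w i, Measurable (M.B w i)
  measurable_d : Measurable fun bp : 𝓑 × RJ J => M.d bp.1 bp.2
  measurable_y : Measurable fun bp : 𝓑 × RJ J => M.y bp.1 bp.2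
  measurable_cutoff : ∀ n, Measurable (M.cutoff n)
  indep : iIndepFun (fun i ω => (M.X i ω, M.B true i ω, M.B false i ω, M.W i ω)) μ
  identDistrib : ∀ i, IdentDistrib
    (fun ω => (M.X i ω, M.B true i ω, M.B false i ω, M.W i ω))
    (fun ω => (M.X 0 ω, M.B true 0 ω, M.B false 0 ω, M.W 0 ω)) μ μ

/-- Identification: unconfoundedness and overlap of the observed treatments. (That submissions
depend on the own treatment only, and allocations and outcomes on treatments only through the
submissions, is built into `Market`.) -/
structure Identification : Prop where
  unconfounded : ∀ i, ∀ s : Set (𝓑 × 𝓑), MeasurableSet s → ∀ t : Set Bool,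
    (μ⟦{ω | (M.B true i ω, M.B false i ω) ∈ s ∧ M.W i ω ∈ t} |
        MeasurableSpace.comap (M.X i) inferInstance⟧) =ᵐ[μ]
      (μ⟦{ω | (M.B true i ω, M.B false i ω) ∈ s} |
        MeasurableSpace.comap (M.X i) inferInstance⟧)
      * (μ⟦{ω | M.W i ω ∈ t} | MeasurableSpace.comap (M.X i) inferInstance⟧)
  overlap : ∃ e : 𝓧 → ℝ, Measurable e ∧
    (∀ i, (fun ω => e (M.X i ω)) =ᵐ[μ]
      (μ⟦{ω | M.W i ω = true} | MeasurableSpace.comap (M.X i) inferInstance⟧)) ∧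
    ∀ x, 0 < e x ∧ e x < 1

/-- Cutoff mechanism: the finite-market cutoffs are in `S`, allocations are bounded, and the
market clears up to `a n = o(n^(-1/2))` with probability at least `1 - exp (-c n)` when the
treatments are drawn from a rule in `Pol`. -/
structure CutoffMechanism (Pol : Set (𝓧 → ℝ)) : Prop where
  cap_mem : ∀ j, M.cap j ∈ Set.Icc (0 : ℝ) 1
  cutoff_mem : ∀ n : ℕ, 0 < n → ∀ b : Fin n → 𝓑, M.cutoff n b ∈ M.S
  bounded_d : ∃ K : ℝ, ∀ b, ∀ p ∈ M.S, ‖M.d b p‖ ≤ K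
  clears : ∃ (a : ℕ → ℝ) (c : ℝ), 0 < c ∧
    Tendsto (fun n : ℕ => a n * Real.sqrt n) atTop (𝓝 0) ∧
    (∀ π ∈ Pol, ∀ n : ℕ, 0 < n →
      1 - Real.exp (-c * n) ≤ ∫ ω, policyExp π (M.covariates n ω)
        (Set.indicator {w | (M.clearing n (a n) w ω).Nonempty} fun _ => 1) ∂μ) ∧
    (∀ n : ℕ, 0 < n → ∀ w : Fin n → Bool, ∀ᵐ ω ∂μ,
      (M.clearing n (a n) w ω).Nonempty → M.P n w ω ∈ M.clearing n (a n) w ω)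

/-- Regularity of outcomes. -/
structure RegularOutcomes (Pol : Set (𝓧 → ℝ)) (pstar : (𝓧 → ℝ) → RJ J)
    (c' c₃ c₄ : ℝ) : Prop where
  entropy : ∃ h_d h_y C : ℝ, 0 < h_d ∧ 0 < h_y ∧ 0 < C ∧
    (∀ j : Fin J, UniformCoveringBound ((fun p b => M.d b p j) '' M.S) C h_d) ∧
    UniformCoveringBound ((fun p b => M.y b p) '' M.S) C h_y
  bounded_y : ∃ K : ℝ, ∀ b, ∀ p ∈ M.S, |M.y b p| ≤ K
  weakly_continuous : ∃ L : ℝ, 0 < L ∧ ∀ w, ∀ p ∈ M.S, ∀ p' ∈ M.S,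
    (∀ j : Fin J, ∫ ω, (M.d (M.B w 0 ω) p j - M.d (M.B w 0 ω) p' j) ^ 2 ∂μ ≤ L * ‖p - p'‖) ∧
    ∫ ω, (M.y (M.B w 0 ω) p - M.y (M.B w 0 ω) p') ^ 2 ∂μ ≤ L * ‖p - p'‖
  /-- Versions `md w x p`, `my w x p` of the conditional means of `d(B_i(w), p)` and
  `y(B_i(w), p)` given `X_i = x` that are smooth in `p`. -/
  smooth : ∃ (md : Bool → 𝓧 → RJ J → RJ J) (my : Bool → 𝓧 → RJ J → ℝ),
    (∀ w, ∀ p ∈ M.S, Measurable (fun x => md w x p) ∧ Measurable (fun x => my w x p)) ∧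
    (∀ w i, ∀ p ∈ M.S,
      (fun ω => md w (M.X i ω) p) =ᵐ[μ]
        μ[fun ω => M.d (M.B w i ω) p | MeasurableSpace.comap (M.X i) inferInstance] ∧
      (fun ω => my w (M.X i ω) p) =ᵐ[μ]
        μ[fun ω => M.y (M.B w i ω) p | MeasurableSpace.comap (M.X i) inferInstance]) ∧
    (∀ w x, (∀ j : Fin J, SmoothBounded (fun p => md w x p j) (interior M.S) c') ∧
      SmoothBounded (my w x) (interior M.S) c')
  jacobian : ∀ π ∈ Pol, ∀ k : ℕ, k < J →
    (fderiv ℝ (M.popZ μ π) (pstar π)).toLinearMap.singularValues k ∈ Set.Icc c₃ c₄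

/-- Regularity of equilibrium. -/
structure RegularEquilibrium (Pol : Set (𝓧 → ℝ)) (pstar : (𝓧 → ℝ) → RJ J)
    (c' c₃ : ℝ) : Prop where
  compact : IsCompact M.S
  equilibrium : ∀ π ∈ Pol, M.IsEquilibrium μ π (pstar π)
  interior : ∃ c₁ : ℝ, 0 < c₁ ∧ ∀ π ∈ Pol, Metric.ball (pstar π) c₁ ⊆ M.S
  well_separated : ∃ c₂ : ℝ, 0 < c₂ ∧ ∀ π ∈ Pol, ∀ p ∈ M.S,
    c₃ / (2 * J * c') ≤ ‖p - pstar π‖ → c₂ ≤ 2 * ‖M.popZ μ π p‖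

end Market

end CutoffMarket

end

/-!
Under a rule `π` the submissions are i.i.d. with a mixture law `ν`, so randomized treatments reduce
to an i.i.d. sample `b` from `ν` with computed cutoffs `P = cutoff n b`. Classes with polynomial
uniform covering numbers obey a maximal inequality at the data-dependent index `P`: an offset
`-t ∑ (increment)²` pays for the choice of the index, and symmetrization bounds the mean of what is
left by `log N / (n t)`. A first use of it, with `t` of order `n^(-1/2 + δ)`, gives a crude rate for
the excess demand at `P`, hence for `P - p*`, because `z_π` is continuous on a compact set, vanishes
only at `p*`, and has an invertible derivative there. The second moments of the increments at `P`
are then small, and a second use replaces the random cutoffs by `p*` up to `o(n^(-1/2))`. Since the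
finite market clears, `φ = ∇y_π (∇z_π)⁻¹` turns the remaining drift of the outcomes into the average
excess demand at `p*`. All remainders are controlled in mean, which survives the expectation over
treatments, and Markov's inequality gives the statements in probability.
-/

noncomputable section

open scoped BigOperators

namespace CutoffMarket

/-! ### Rademacher averages -/

section Rademacher

variable {ι : Type*} [Fintype ι]

/-- The sign attached to a Boolean, so that a uniformly distributed element of `ι → Bool` is a
family of independent Rademacher signs. -/
def boolSign (b : Bool) : ℝ := if b then 1 else -1

theorem boolSign_sq (b : Bool) : boolSign b ^ 2 = 1 := by
  cases b <;> simp [boolSign]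

/-- The sum of the numbers `a i` with the signs `σ i`. -/
def rademacherSum (σ : ι → Bool) (a : ι → ℝ) : ℝ := ∑ i, boolSign (σ i) * a i

theorem rademacherSum_neg (σ : ι → Bool) (a : ι → ℝ) :
    rademacherSum σ (-a) = -rademacherSum σ a := by
  simp [rademacherSum]

theorem rademacherSum_smul (σ : ι → Bool) (t : ℝ) (a : ι → ℝ) :
    rademacherSum σ (t • a) = t * rademacherSum σ a := by
  simp only [rademacherSum, Pi.smul_apply, smul_eq_mul, Finset.mul_sum, mul_left_comm]

theorem rademacherSum_sub (σ : ι → Bool) (a a' : ι → ℝ) :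
    rademacherSum σ (a - a') = rademacherSum σ a - rademacherSum σ a' := by
  simp only [rademacherSum, Pi.sub_apply, mul_sub, Finset.sum_sub_distrib]

theorem abs_rademacherSum_div_card_le (σ : ι → Bool) {a : ι → ℝ} {δ : ℝ} (hδ : 0 ≤ δ)
    (ha : 𝔼 i, a i ^ 2 ≤ δ ^ 2) : |rademacherSum σ a / Fintype.card ι| ≤ δ := by
  refine abs_le_of_sq_le_sq ?_ hδ
  rw [rademacherSum, ← Fintype.expect_eq_sum_div_card]
  calc (𝔼 i, boolSign (σ i) * a i) ^ 2
      ≤ (𝔼 i, boolSign (σ i) ^ 2) * 𝔼 i, a i ^ 2 := Finset.expect_mul_sq_le_sq_mul_sq _ _ _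
    _ ≤ 1 * δ ^ 2 := by
        gcongr
        rcases isEmpty_or_nonempty ι with _ | _ <;> simp [boolSign_sq]
    _ = δ ^ 2 := one_mul _

variable [DecidableEq ι]

theorem expect_prod_pi {β : Type*} [Fintype β] (f : ι → β → ℝ) :
    𝔼 x : ι → β, ∏ i, f i (x i) = ∏ i, 𝔼 b, f i b := by
  simp only [Fintype.expect_eq_sum_div_card, Finset.prod_div_distrib, Finset.prod_univ_sum,
    Fintype.piFinset_univ, Finset.prod_const, Finset.card_univ, Fintype.card_fun, Nat.cast_pow]

theorem expect_exp_rademacherSum_le (a : ι → ℝ) :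
    𝔼 σ : ι → Bool, Real.exp (rademacherSum σ a) ≤ Real.exp ((∑ i, a i ^ 2) / 2) := by
  calc 𝔼 σ : ι → Bool, Real.exp (rademacherSum σ a)
      = ∏ i, Real.cosh (a i) := by
        simp only [rademacherSum, Real.exp_sum]
        rw [expect_prod_pi fun i b => Real.exp (boolSign b * a i)]
        refine Finset.prod_congr rfl fun i _ => ?_
        rw [Fintype.expect_eq_sum_div_card, Real.cosh_eq]
        simp [boolSign]
    _ ≤ ∏ i, Real.exp (a i ^ 2 / 2) :=
        Finset.prod_le_prod (fun i _ => (Real.cosh_pos _).le)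
          fun i _ => Real.cosh_le_exp_half_sq _
    _ = Real.exp ((∑ i, a i ^ 2) / 2) := by rw [← Real.exp_sum, Finset.sum_div]

theorem expect_exp_abs_rademacherSum_sub_le (a : ι → ℝ) :
    𝔼 σ : ι → Bool, Real.exp (|rademacherSum σ a| - (∑ i, a i ^ 2) / 2) ≤ 2 := by
  have one_sided : ∀ a : ι → ℝ,
      𝔼 σ : ι → Bool, Real.exp (rademacherSum σ a - (∑ i, a i ^ 2) / 2) ≤ 1 := fun a => by
    simp only [Real.exp_sub, ← Finset.expect_div]
    exact (div_le_one (Real.exp_pos _)).2 (expect_exp_rademacherSum_le a)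
  have exp_abs_le : ∀ x s : ℝ, Real.exp (|x| - s) ≤ Real.exp (x - s) + Real.exp (-x - s) := by
    intro x s
    rcases abs_choice x with h | h <;> rw [h]
    · exact le_add_of_nonneg_right (Real.exp_pos _).le
    · exact le_add_of_nonneg_left (Real.exp_pos _).le
  calc 𝔼 σ : ι → Bool, Real.exp (|rademacherSum σ a| - (∑ i, a i ^ 2) / 2)
      ≤ 𝔼 σ : ι → Bool, Real.exp (rademacherSum σ a - (∑ i, a i ^ 2) / 2)
        + 𝔼 σ : ι → Bool, Real.exp (rademacherSum σ (-a) - (∑ i, (-a) i ^ 2) / 2) := by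
        rw [← Finset.expect_add_distrib]
        refine Finset.expect_le_expect fun σ _ => ?_
        simpa only [rademacherSum_neg, Pi.neg_apply, neg_sq] using exp_abs_le _ _
    _ ≤ 1 + 1 := add_le_add (one_sided a) (one_sided (-a))
    _ = 2 := one_add_one_eq_two

theorem expect_le_log_expect_exp {α : Type*} [Fintype α] [Nonempty α] (f : α → ℝ) :
    𝔼 x, f x ≤ Real.log (𝔼 x, Real.exp (f x)) := by
  have card_pos : (0 : ℝ) < Fintype.card α := by exact_mod_cast Fintype.card_pos
  have jensen := convexOn_exp.map_sum_le (t := Finset.univ)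
    (w := fun _ : α => (Fintype.card α : ℝ)⁻¹) (p := f) (fun _ _ => by positivity)
    (by simp [card_pos.ne']) (fun _ _ => Set.mem_univ _)
  rw [Real.le_log_iff_exp_le (Finset.expect_pos (fun _ _ => Real.exp_pos _)
    Finset.univ_nonempty)]
  simpa only [Fintype.expect_eq_sum_div_card, smul_eq_mul, Finset.sum_div,
    ← div_eq_inv_mul] using jensen

/-- The vector `v σ` may depend on the signs: the offset `(∑ i, v σ i ^ 2) / 2` pays for its
size, and only the choice of an element of `A` has to be paid for by `log #A`. -/
theorem expect_abs_rademacherSum_sub_le {A : Finset (ι → ℝ)} {v : (ι → Bool) → ι → ℝ}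
    (hv : ∀ σ, v σ ∈ A) :
    𝔼 σ, (|rademacherSum σ (v σ)| - (∑ i, v σ i ^ 2) / 2) ≤ Real.log (2 * A.card) := by
  refine (expect_le_log_expect_exp _).trans (Real.log_le_log
    (Finset.expect_pos (fun _ _ => Real.exp_pos _) Finset.univ_nonempty) ?_)
  calc 𝔼 σ, Real.exp (|rademacherSum σ (v σ)| - (∑ i, v σ i ^ 2) / 2)
      ≤ 𝔼 σ, ∑ a ∈ A, Real.exp (|rademacherSum σ a| - (∑ i, a i ^ 2) / 2) :=
        Finset.expect_le_expect fun σ _ => Finset.single_le_sum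
          (f := fun a : ι → ℝ => Real.exp (|rademacherSum σ a| - (∑ i, a i ^ 2) / 2))
          (fun _ _ => (Real.exp_pos _).le) (hv σ)
    _ = ∑ a ∈ A, 𝔼 σ, Real.exp (|rademacherSum σ a| - (∑ i, a i ^ 2) / 2) :=
        Finset.expect_sum_comm _ _ _
    _ ≤ A.card • 2 := Finset.sum_le_card_nsmul _ _ _ fun a _ =>
        expect_exp_abs_rademacherSum_sub_le a
    _ = 2 * A.card := by rw [nsmul_eq_mul, mul_comm]

theorem expect_abs_rademacherSum_sub_mul_le {A : Finset (ι → ℝ)} {v : (ι → Bool) → ι → ℝ}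
    (hv : ∀ σ, v σ ∈ A) {t : ℝ} (ht : 0 < t) :
    𝔼 σ, (|rademacherSum σ (v σ)| - t / 2 * ∑ i, v σ i ^ 2) ≤ Real.log (2 * A.card) / t := by
  classical
  have scaled := expect_abs_rademacherSum_sub_le (A := A.image (t • ·)) (v := fun σ => t • v σ)
    fun σ => Finset.mem_image_of_mem _ (hv σ)
  have factor : ∀ σ, |rademacherSum σ (t • v σ)| - (∑ i, (t • v σ) i ^ 2) / 2
      = t * (|rademacherSum σ (v σ)| - t / 2 * ∑ i, v σ i ^ 2) := fun σ => by
    simp only [rademacherSum_smul, abs_mul, abs_of_pos ht, Pi.smul_apply, smul_eq_mul, mul_pow,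
      ← Finset.mul_sum]
    ring
  rw [Finset.expect_congr rfl fun σ _ => factor σ, ← Finset.mul_expect,
    Finset.card_image_of_injective _ (smul_right_injective _ ht.ne')] at scaled
  rwa [le_div_iff₀' ht]

theorem expect_abs_rademacherSum_offset_le [Nonempty ι] {A : Finset (ι → ℝ)}
    {u : (ι → Bool) → ι → ℝ} {δ : ℝ} (hδ : 0 ≤ δ)
    (hu : ∀ σ, ∃ a ∈ A, 𝔼 i, (u σ i - a i) ^ 2 ≤ δ ^ 2) {t : ℝ} (ht : 0 < t) :
    𝔼 σ, (|rademacherSum σ (u σ) / Fintype.card ι| - t * 𝔼 i, u σ i ^ 2)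
      ≤ δ + t * δ ^ 2 + Real.log (2 * A.card) / (t * Fintype.card ι) := by
  choose v hvA hv using hu
  set n : ℝ := (Fintype.card ι : ℝ) with n_def
  have hn : 0 < n := Nat.cast_pos.2 Fintype.card_pos
  have to_net : ∀ σ, |rademacherSum σ (u σ) / n| - t * 𝔼 i, u σ i ^ 2
      ≤ δ + t * δ ^ 2 + (|rademacherSum σ (v σ)| - t / 2 * ∑ i, v σ i ^ 2) / n := by
    intro σ
    have sum_le : |rademacherSum σ (u σ) / n| ≤ |rademacherSum σ (v σ)| / n + δ := by
      have h := abs_rademacherSum_div_card_le σ (a := u σ - v σ) hδ (hv σ)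
      rw [rademacherSum_sub, sub_div] at h
      rw [← abs_of_pos hn, ← abs_div, abs_of_pos hn]
      linarith [abs_sub_abs_le_abs_sub (rademacherSum σ (u σ) / n) (rademacherSum σ (v σ) / n)]
    have sq_le : 𝔼 i, v σ i ^ 2 ≤ 2 * 𝔼 i, u σ i ^ 2 + 2 * δ ^ 2 := by
      calc 𝔼 i, v σ i ^ 2 ≤ 𝔼 i, (2 * u σ i ^ 2 + 2 * (u σ i - v σ i) ^ 2) :=
            Finset.expect_le_expect fun i _ => by nlinarith [sq_nonneg (2 * u σ i - v σ i)]
        _ = 2 * 𝔼 i, u σ i ^ 2 + 2 * 𝔼 i, (u σ i - v σ i) ^ 2 := by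
            rw [Finset.expect_add_distrib, Finset.mul_expect, Finset.mul_expect]
        _ ≤ 2 * 𝔼 i, u σ i ^ 2 + 2 * δ ^ 2 := by linarith [hv σ]
    rw [sub_div, mul_div_assoc, n_def, ← Fintype.expect_eq_sum_div_card, ← n_def]
    linarith [mul_le_mul_of_nonneg_left sq_le ht.le]
  calc 𝔼 σ, (|rademacherSum σ (u σ) / n| - t * 𝔼 i, u σ i ^ 2)
      ≤ 𝔼 σ, (δ + t * δ ^ 2 + (|rademacherSum σ (v σ)| - t / 2 * ∑ i, v σ i ^ 2) / n) :=
        Finset.expect_le_expect fun σ _ => to_net σ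
    _ = δ + t * δ ^ 2 + (𝔼 σ, (|rademacherSum σ (v σ)| - t / 2 * ∑ i, v σ i ^ 2)) / n := by
        rw [Finset.expect_add_distrib, Fintype.expect_const, Finset.expect_div]
    _ ≤ δ + t * δ ^ 2 + Real.log (2 * A.card) / t / n := by
        gcongr
        exact expect_abs_rademacherSum_sub_mul_le hvA ht
    _ = δ + t * δ ^ 2 + Real.log (2 * A.card) / (t * n) := by rw [div_div]

end Rademacher

/-! ### Covers in empirical `L₂` distances -/

section Covers

variable {𝓑 : Type*} {F : Set (𝓑 → ℝ)} {m : ℕ} {N ε C h K : ℝ}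

/-- For every sample of size `m`, the class `F` has an `ε`-net of at most `N` functions in the
`L₂` distance of the empirical distribution. -/
def EmpiricalCover (F : Set (𝓑 → ℝ)) (m : ℕ) (N ε : ℝ) : Prop :=
  ∀ x : Fin m → 𝓑, ∃ G : Finset (𝓑 → ℝ), (G.card : ℝ) ≤ N ∧
    ∀ f ∈ F, ∃ g ∈ G, 𝔼 i, (f (x i) - g (x i)) ^ 2 ≤ ε ^ 2

theorem EmpiricalCover.image_of_sq_sub_le (hF : EmpiricalCover F m N ε) {c : ℝ}
    {Φ Ψ : (𝓑 → ℝ) → 𝓑 → ℝ}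
    (hΦ : ∀ f ∈ F, ∀ g b, (Φ f b - Ψ g b) ^ 2 ≤ c ^ 2 * (f b - g b) ^ 2) :
    EmpiricalCover (Φ '' F) m N (c * ε) := by
  classical
  intro x
  obtain ⟨G, hN, hG⟩ := hF x
  refine ⟨G.image Ψ, le_trans (by exact_mod_cast Finset.card_image_le) hN, ?_⟩
  rintro _ ⟨f, hf, rfl⟩
  obtain ⟨g, hg, hle⟩ := hG f hf
  refine ⟨Ψ g, Finset.mem_image_of_mem _ hg, ?_⟩
  calc 𝔼 i, (Φ f (x i) - Ψ g (x i)) ^ 2 ≤ 𝔼 i, c ^ 2 * (f (x i) - g (x i)) ^ 2 :=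
        Finset.expect_le_expect fun i _ => hΦ f hf g _
    _ ≤ (c * ε) ^ 2 := by
        rw [← Finset.mul_expect, mul_pow]
        gcongr

theorem exists_finset_l2Dist_lt {k : ℕ} {pt : Fin k → 𝓑} {wt : Fin k → ℝ} (hC : 0 ≤ C)
    (hF : (coveringNumber pt wt ε F : ENNReal) ≤ ENNReal.ofReal C) :
    ∃ G : Finset (𝓑 → ℝ), (G.card : ℝ) ≤ C ∧ ∀ f ∈ F, ∃ g ∈ G, l2Dist pt wt f g < ε := by
  have ne_top : coveringNumber pt wt ε F ≠ ⊤ := fun h => by simp [h] at hF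
  obtain ⟨G, hG, hcard⟩ : ∃ G : Finset (𝓑 → ℝ), (∀ f ∈ F, ∃ g ∈ G, l2Dist pt wt f g < ε) ∧
      (G.card : ℕ∞) < coveringNumber pt wt ε F + 1 := by
    simpa only [coveringNumber, iInf_lt_iff, exists_prop] using
      (ENat.lt_add_one_iff ne_top).2 (le_refl (coveringNumber pt wt ε F))
  refine ⟨G, ?_, hG⟩
  have card_le := (ENat.toENNReal_le.2 ((ENat.lt_add_one_iff ne_top).1 hcard)).trans hF
  rw [ENat.toENNReal_coe, ← ENNReal.ofReal_natCast] at card_le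
  exact (ENNReal.ofReal_le_ofReal_iff hC).1 card_le

theorem UniformCoveringBound.empiricalCover (hF : UniformCoveringBound F C h) (hC : 0 ≤ C)
    (hm : 0 < m) (hε : 0 < ε) (hε1 : ε < 1) : EmpiricalCover F m (C * (1 / ε) ^ h) ε := by
  intro x
  have uniform_mem : (fun _ : Fin m => (1 / m : ℝ)) ∈ stdSimplex ℝ (Fin m) :=
    ⟨fun _ => by positivity, by simp [hm.ne']⟩
  obtain ⟨G, hcard, hG⟩ := exists_finset_l2Dist_lt (pt := x) (wt := fun _ => (1 / m : ℝ))
    (C := C * (1 / ε) ^ h) (by positivity) <| (hF ε hε hε1).trans' <|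
      le_iSup_of_le m <| le_iSup_of_le x <| le_iSup_of_le _ <| le_iSup_of_le uniform_mem le_rfl
  refine ⟨G, hcard, fun f hf => ?_⟩
  obtain ⟨g, hg, hlt⟩ := hG f hf
  refine ⟨g, hg, ?_⟩
  have h_sq := (Real.sqrt_lt' hε).1 hlt
  rw [← Finset.mul_sum, one_div, inv_mul_eq_div] at h_sq
  rw [Fintype.expect_eq_sum_div_card, Fintype.card_fin]
  exact h_sq.le

/-- The empirical covering numbers of `F` are polynomial in `1 / ε`, up to a fixed rescaling of
the distances. -/
def PolynomialCovers (F : Set (𝓑 → ℝ)) : Prop :=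
  ∃ C h c : ℝ, 0 < C ∧ 0 ≤ c ∧ ∀ m : ℕ, 0 < m → ∀ ε : ℝ, 0 < ε → ε < 1 →
    EmpiricalCover F m (C * (1 / ε) ^ h) (c * ε)

theorem UniformCoveringBound.polynomialCovers (hF : UniformCoveringBound F C h) (hC : 0 < C) :
    PolynomialCovers F :=
  ⟨C, h, 1, hC, zero_le_one, fun _ hm ε hε hε1 => by
    rw [one_mul]
    exact hF.empiricalCover hC.le hm hε hε1⟩

theorem PolynomialCovers.image_of_sq_sub_le (hF : PolynomialCovers F) {c : ℝ} (hc : 0 ≤ c)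
    {Φ Ψ : (𝓑 → ℝ) → 𝓑 → ℝ}
    (hΦ : ∀ f ∈ F, ∀ g b, (Φ f b - Ψ g b) ^ 2 ≤ c ^ 2 * (f b - g b) ^ 2) :
    PolynomialCovers (Φ '' F) := by
  obtain ⟨C, h, c₀, hC, hc₀, hcov⟩ := hF
  refine ⟨C, h, c * c₀, hC, mul_nonneg hc hc₀, fun m hm ε hε hε1 => ?_⟩
  rw [mul_assoc]
  exact (hcov m hm ε hε hε1).image_of_sq_sub_le hΦ

theorem PolynomialCovers.sub_const (hF : PolynomialCovers F) (f₀ : 𝓑 → ℝ) :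
    PolynomialCovers ((fun f b => f b - f₀ b) '' F) :=
  hF.image_of_sq_sub_le zero_le_one (Ψ := fun g b => g b - f₀ b) fun f _ g b => by
    rw [sub_sub_sub_cancel_right, one_pow, one_mul]

/-- The functions of a net need not be bounded: they are truncated before squaring. -/
theorem PolynomialCovers.sq_sub (hF : PolynomialCovers F) (hb : ∀ f ∈ F, ∀ b, |f b| ≤ K)
    {f₀ : 𝓑 → ℝ} (h₀ : ∀ b, |f₀ b| ≤ K) :
    PolynomialCovers ((fun f b => (f b - f₀ b) ^ 2) '' F) := by
  have hK : -|K| ≤ |K| := neg_le_self (abs_nonneg K)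
  set clamp : ℝ → ℝ := fun r => Set.projIcc (-|K|) |K| hK r
  refine hF.image_of_sq_sub_le (c := 4 * |K|) (by positivity)
    (Ψ := fun g b => (clamp (g b) - f₀ b) ^ 2) fun f hf g b => ?_
  obtain ⟨f_ge, f_le⟩ := abs_le.1 ((hb f hf b).trans (le_abs_self K))
  obtain ⟨f₀_ge, f₀_le⟩ := abs_le.1 ((h₀ b).trans (le_abs_self K))
  obtain ⟨clamp_ge, clamp_le⟩ : clamp (g b) ∈ Set.Icc (-|K|) |K| := Subtype.coe_prop _
  have clamp_closer : |f b - clamp (g b)| ≤ |f b - g b| := by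
    have h := (LipschitzWith.projIcc hK).dist_le_mul (f b) (g b)
    rwa [Set.projIcc_of_mem _ ⟨f_ge, f_le⟩, NNReal.coe_one, one_mul] at h
  calc ((f b - f₀ b) ^ 2 - (clamp (g b) - f₀ b) ^ 2) ^ 2
      = (f b + clamp (g b) - 2 * f₀ b) ^ 2 * (f b - clamp (g b)) ^ 2 := by ring
    _ ≤ (4 * |K|) ^ 2 * (f b - g b) ^ 2 :=
        mul_le_mul (sq_le_sq' (by linarith) (by linarith)) (sq_le_sq.2 clamp_closer)
          (sq_nonneg _) (sq_nonneg _)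

end Covers

/-! ### Symmetrization at a data-dependent index -/

section SampleMeans

variable {α ι : Type*} [MeasurableSpace α] {μ : Measure α}

@[fun_prop]
theorem measurable_expect {s : Finset ι} {f : ι → α → ℝ} (hf : ∀ i, Measurable (f i)) :
    Measurable fun a => 𝔼 i ∈ s, f i a := by
  simp only [Finset.expect_eq_sum_div_card]
  fun_prop

theorem integral_expect {s : Finset ι} {f : ι → α → ℝ} (hf : ∀ i ∈ s, Integrable (f i) μ) :
    ∫ a, 𝔼 i ∈ s, f i a ∂μ = 𝔼 i ∈ s, ∫ a, f i a ∂μ := by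
  simp only [Finset.expect_eq_sum_div_card]
  rw [integral_div, integral_finsetSum s hf]

theorem integrable_expect {s : Finset ι} {f : ι → α → ℝ} (hf : ∀ i ∈ s, Integrable (f i) μ) :
    Integrable (fun a => 𝔼 i ∈ s, f i a) μ := by
  simp only [Finset.expect_eq_sum_div_card]
  exact (integrable_finsetSum s hf).div_const _

theorem integrable_of_abs_le [IsFiniteMeasure μ] {f : α → ℝ} (hf : Measurable f) {K : ℝ}
    (hK : ∀ a, |f a| ≤ K) : Integrable f μ :=
  .of_bound hf.aestronglyMeasurable K (Eventually.of_forall hK)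

theorem abs_expect_le_of_abs_le {s : Finset ι} (hs : s.Nonempty) {f : ι → ℝ} {K : ℝ}
    (hK : ∀ i, |f i| ≤ K) : |𝔼 i ∈ s, f i| ≤ K :=
  (s.abs_expect_le f).trans (Finset.expect_le hs fun i _ => hK i)

/-- The law of an i.i.d. sample of size `n`. -/
abbrev sampleLaw (μ : Measure α) (n : ℕ) : Measure (Fin n → α) := Measure.pi fun _ => μ

variable [IsProbabilityMeasure μ] {n : ℕ} [NeZero n]

theorem integral_expect_sampleLaw {f : α → ℝ} (hf : Integrable f μ) :
    ∫ b, 𝔼 i, f (b i) ∂sampleLaw μ n = ∫ x, f x ∂μ := by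
  rw [integral_expect fun i _ => integrable_comp_eval hf]
  simp only [integral_comp_eval (μ := fun _ : Fin n => μ) hf.aestronglyMeasurable,
    Fintype.expect_const]

end SampleMeans

section Symmetrization

variable {𝓑 Θ : Type*} {n : ℕ} {F : Set (𝓑 → ℝ)} {S : Set Θ} {g : 𝓑 → Θ → ℝ}
  {P : (Fin n → 𝓑) → Θ} {N ε t K : ℝ}

theorem expect_fin_append (f : 𝓑 → ℝ) (x y : Fin n → 𝓑) :
    𝔼 i, f (Fin.append x y i) = (𝔼 i, f (x i) + 𝔼 i, f (y i)) / 2 := by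
  simp only [Fintype.expect_eq_sum_div_card, Fintype.card_fin, Fin.sum_univ_add,
    Fin.append_left, Fin.append_right, Nat.cast_add]
  rw [← add_div, div_div, mul_two]

/-- The net is the one of the pooled sample. -/
theorem EmpiricalCover.exists_finset_sub (hF : EmpiricalCover F (n + n) N ε)
    (x y : Fin n → 𝓑) :
    ∃ A : Finset (Fin n → ℝ), (A.card : ℝ) ≤ N ∧
      ∀ f ∈ F, ∃ a ∈ A, 𝔼 i, (f (x i) - f (y i) - a i) ^ 2 ≤ (2 * ε) ^ 2 := by
  classical
  obtain ⟨G, hN, hG⟩ := hF (Fin.append x y)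
  refine ⟨G.image fun h i => h (x i) - h (y i),
    le_trans (by exact_mod_cast Finset.card_image_le) hN, fun f hf => ?_⟩
  obtain ⟨h, hh, hle⟩ := hG f hf
  refine ⟨_, Finset.mem_image_of_mem _ hh, ?_⟩
  rw [expect_fin_append fun b => (f b - h b) ^ 2] at hle
  calc 𝔼 i, (f (x i) - f (y i) - (h (x i) - h (y i))) ^ 2
      ≤ 𝔼 i, (2 * (f (x i) - h (x i)) ^ 2 + 2 * (f (y i) - h (y i)) ^ 2) :=
        Finset.expect_le_expect fun i _ => by
          nlinarith [sq_nonneg (f (x i) - h (x i) + (f (y i) - h (y i)))]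
    _ = 4 * ((𝔼 i, (f (x i) - h (x i)) ^ 2 + 𝔼 i, (f (y i) - h (y i)) ^ 2) / 2) := by
        rw [Finset.expect_add_distrib, ← Finset.mul_expect, ← Finset.mul_expect]
        ring
    _ ≤ (2 * ε) ^ 2 := by linarith

/-- Exchange the two samples in the coordinates where `σ` is `false`. -/
def swapBy (σ : Fin n → Bool) (z : (Fin n → 𝓑) × (Fin n → 𝓑)) :
    (Fin n → 𝓑) × (Fin n → 𝓑) :=
  (fun i => if σ i then z.1 i else z.2 i, fun i => if σ i then z.2 i else z.1 i)

/-- The differences of `g` between two samples, at the index that `P` computes from the first. -/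
def sampleDiff (g : 𝓑 → Θ → ℝ) (P : (Fin n → 𝓑) → Θ) (z : (Fin n → 𝓑) × (Fin n → 𝓑)) :
    Fin n → ℝ :=
  fun i => g (z.1 i) (P z.1) - g (z.2 i) (P z.1)

/-- The deviation between the two sample means of `g`, reduced by `t` times the quadratic mean of
the differences. -/
def offsetDeviation (g : 𝓑 → Θ → ℝ) (P : (Fin n → 𝓑) → Θ) (t : ℝ)
    (z : (Fin n → 𝓑) × (Fin n → 𝓑)) : ℝ :=
  |𝔼 i, sampleDiff g P z i| - t * 𝔼 i, sampleDiff g P z i ^ 2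

theorem offsetDeviation_swapBy (σ : Fin n → Bool) (z : (Fin n → 𝓑) × (Fin n → 𝓑)) :
    ∃ p, p = P (swapBy σ z).1 ∧ offsetDeviation g P t (swapBy σ z)
      = |rademacherSum σ (fun i => g (z.1 i) p - g (z.2 i) p) / Fintype.card (Fin n)|
        - t * 𝔼 i, (g (z.1 i) p - g (z.2 i) p) ^ 2 := by
  refine ⟨_, rfl, ?_⟩
  have sign_diff : ∀ i, sampleDiff g P (swapBy σ z) i = boolSign (σ i)
      * (g (z.1 i) (P (swapBy σ z).1) - g (z.2 i) (P (swapBy σ z).1)) := fun i => by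
    cases h : σ i <;> simp [sampleDiff, swapBy, boolSign, h]
  simp only [offsetDeviation, sign_diff, mul_pow, boolSign_sq, one_mul, rademacherSum,
    ← Fintype.expect_eq_sum_div_card]

theorem expect_offsetDeviation_swapBy_le [NeZero n] (hPS : ∀ b, P b ∈ S) (hε : 0 ≤ ε)
    (hcov : EmpiricalCover ((fun p b => g b p) '' S) (n + n) N ε) (ht : 0 < t)
    (z : (Fin n → 𝓑) × (Fin n → 𝓑)) :
    𝔼 σ, offsetDeviation g P t (swapBy σ z)
      ≤ 2 * ε + t * (2 * ε) ^ 2 + Real.log (2 * N) / (t * n) := by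
  obtain ⟨A, hAN, hA⟩ := hcov.exists_finset_sub z.1 z.2
  choose p hp h_swap using fun σ => offsetDeviation_swapBy (g := g) (P := P) (t := t) σ z
  have hpS : ∀ σ, p σ ∈ S := fun σ => hp σ ▸ hPS _
  have hA_pos : (0 : ℝ) < A.card := by
    obtain ⟨a, ha, -⟩ := hA _ ⟨_, hpS fun _ => true, rfl⟩
    exact_mod_cast Finset.card_pos.2 ⟨a, ha⟩
  simp only [h_swap]
  refine (expect_abs_rademacherSum_offset_le (by positivity)
    (fun σ => hA _ ⟨_, hpS σ, rfl⟩) ht).trans ?_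
  rw [Fintype.card_fin]
  gcongr

variable [MeasurableSpace 𝓑]

theorem measurePreserving_swapBy (ν : Measure 𝓑) [IsProbabilityMeasure ν] (σ : Fin n → Bool) :
    MeasurePreserving (swapBy σ) ((sampleLaw ν n).prod (sampleLaw ν n))
      ((sampleLaw ν n).prod (sampleLaw ν n)) := by
  have pairing := measurePreserving_arrowProdEquivProdArrow 𝓑 𝓑 (Fin n) (fun _ => ν) (fun _ => ν)
  have swap_pairs : MeasurePreserving
      (fun (z : Fin n → 𝓑 × 𝓑) i => (if σ i then id else Prod.swap : 𝓑 × 𝓑 → 𝓑 × 𝓑) (z i))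
      (Measure.pi fun _ => ν.prod ν) (Measure.pi fun _ => ν.prod ν) := by
    refine measurePreserving_pi (fun _ => ν.prod ν) (fun _ => ν.prod ν) fun i => ?_
    cases σ i
    · exact Measure.measurePreserving_swap
    · exact .id _
  convert (pairing.comp swap_pairs).comp pairing.symm using 1
  funext z
  refine Prod.ext (funext fun i => ?_) (funext fun i => ?_) <;>
  · cases h : σ i <;>
      simp [swapBy, MeasurableEquiv.arrowProdEquivProdArrow, Equiv.arrowProdEquivProdArrow, h]

variable [MeasurableSpace Θ]

/-- A jointly measurable family of functions `g · p` that is bounded by `K` for `p ∈ S`. -/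
structure BoundedFamily (g : 𝓑 → Θ → ℝ) (S : Set Θ) (K : ℝ) : Prop where
  measurable : Measurable (Function.uncurry g)
  bounded : ∀ b, ∀ p ∈ S, |g b p| ≤ K

/-- Sample mean minus population mean of `g`, at the index that `P` computes from the sample. -/
def empiricalDeviation {E : Type*} [NormedAddCommGroup E] [NormedSpace ℝ E] [Module ℚ≥0 E]
    (ν : Measure 𝓑) (g : 𝓑 → Θ → E) (P : (Fin n → 𝓑) → Θ) (b : Fin n → 𝓑) : E :=
  𝔼 i, g (b i) (P b) - ∫ x, g x (P b) ∂ν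

namespace BoundedFamily

theorem sq_le (hg : BoundedFamily g S K) (b : 𝓑) {p : Θ} (hp : p ∈ S) : g b p ^ 2 ≤ K ^ 2 :=
  sq_le_sq' (abs_le.1 (hg.bounded b p hp)).1 (abs_le.1 (hg.bounded b p hp)).2

theorem integrable_apply (hg : BoundedFamily g S K) {ν : Measure 𝓑} [IsFiniteMeasure ν]
    {p : Θ} (hp : p ∈ S) : Integrable (g · p) ν :=
  integrable_of_abs_le (have := hg.measurable; by fun_prop) fun b => hg.bounded b p hp

theorem sq (hg : BoundedFamily g S K) : BoundedFamily (fun b p => g b p ^ 2) S (K ^ 2) where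
  measurable := have := hg.measurable; by unfold Function.uncurry; fun_prop
  bounded b p hp := by
    rw [abs_pow, sq_abs]
    exact hg.sq_le b hp

theorem abs_sampleDiff_le (hg : BoundedFamily g S K) (hPS : ∀ b, P b ∈ S)
    (z : (Fin n → 𝓑) × (Fin n → 𝓑)) (i : Fin n) : |sampleDiff g P z i| ≤ 2 * K := by
  have h := abs_sub (g (z.1 i) (P z.1)) (g (z.2 i) (P z.1))
  rw [sampleDiff]
  linarith [hg.bounded (z.1 i) _ (hPS z.1), hg.bounded (z.2 i) _ (hPS z.1)]

variable {ν : Measure 𝓑} [IsProbabilityMeasure ν]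

theorem abs_integral_le (hg : BoundedFamily g S K) {p : Θ} (hp : p ∈ S) :
    |∫ x, g x p ∂ν| ≤ K := by
  simpa using norm_integral_le_of_norm_le_const (μ := ν) (f := (g · p))
    (Eventually.of_forall fun b => hg.bounded b p hp)

theorem measurable_integral (hg : BoundedFamily g S K) : Measurable fun p => ∫ x, g x p ∂ν :=
  (hg.measurable.comp measurable_swap).stronglyMeasurable.integral_prod_right'.measurable

theorem integrable_integral_apply (hg : BoundedFamily g S K) (hP : Measurable P)
    (hPS : ∀ b, P b ∈ S) : Integrable (fun b => ∫ x, g x (P b) ∂ν) (sampleLaw ν n) :=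
  integrable_of_abs_le (hg.measurable_integral.comp hP) fun b => hg.abs_integral_le (hPS b)

variable [NeZero n]

theorem integrable_expect_sampleDiff (hg : BoundedFamily g S K) (hP : Measurable P)
    (hPS : ∀ b, P b ∈ S) :
    Integrable (fun z => 𝔼 i, sampleDiff g P z i) ((sampleLaw ν n).prod (sampleLaw ν n)) := by
  have := hg.measurable
  refine integrable_of_abs_le (K := 2 * K) (by unfold sampleDiff; fun_prop) fun z =>
    abs_expect_le_of_abs_le Finset.univ_nonempty (hg.abs_sampleDiff_le hPS z)

theorem integrable_expect_sampleDiff_sq (hg : BoundedFamily g S K) (hP : Measurable P)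
    (hPS : ∀ b, P b ∈ S) :
    Integrable (fun z => 𝔼 i, sampleDiff g P z i ^ 2)
      ((sampleLaw ν n).prod (sampleLaw ν n)) := by
  have := hg.measurable
  refine integrable_of_abs_le (K := (2 * K) ^ 2) (by unfold sampleDiff; fun_prop) fun z =>
    abs_expect_le_of_abs_le Finset.univ_nonempty fun i => ?_
  rw [abs_pow]
  exact pow_le_pow_left₀ (abs_nonneg _) (hg.abs_sampleDiff_le hPS z i) 2

theorem integral_offsetDeviation_le (hg : BoundedFamily g S K) (hP : Measurable P)
    (hPS : ∀ b, P b ∈ S) (hε : 0 ≤ ε)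
    (hcov : EmpiricalCover ((fun p b => g b p) '' S) (n + n) N ε) (ht : 0 < t) :
    ∫ z, offsetDeviation g P t z ∂(sampleLaw ν n).prod (sampleLaw ν n)
      ≤ 2 * ε + t * (2 * ε) ^ 2 + Real.log (2 * N) / (t * n) := by
  set Q := (sampleLaw ν n).prod (sampleLaw ν n)
  have h_int : Integrable (offsetDeviation g P t) Q :=
    (hg.integrable_expect_sampleDiff hP hPS).abs.sub
      ((hg.integrable_expect_sampleDiff_sq hP hPS).const_mul t)
  have h_swap_int : ∀ σ, Integrable (fun z => offsetDeviation g P t (swapBy σ z)) Q := fun σ =>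
    (measurePreserving_swapBy ν σ).integrable_comp_of_integrable h_int
  have h_swap : ∀ σ, ∫ z, offsetDeviation g P t (swapBy σ z) ∂Q
      = ∫ z, offsetDeviation g P t z ∂Q := fun σ => by
    have h := measurePreserving_swapBy ν σ
    rw [← integral_map h.aemeasurable (h.map_eq.symm ▸ h_int.aestronglyMeasurable), h.map_eq]
  calc ∫ z, offsetDeviation g P t z ∂Q
      = 𝔼 σ : Fin n → Bool, ∫ z, offsetDeviation g P t (swapBy σ z) ∂Q := by
        simp only [h_swap, Fintype.expect_const]
    _ = ∫ z, 𝔼 σ, offsetDeviation g P t (swapBy σ z) ∂Q :=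
        (integral_expect fun σ _ => h_swap_int σ).symm
    _ ≤ ∫ _, (2 * ε + t * (2 * ε) ^ 2 + Real.log (2 * N) / (t * n)) ∂Q :=
        integral_mono (integrable_expect fun σ _ => h_swap_int σ) (integrable_const _)
          (expect_offsetDeviation_swapBy_le hPS hε hcov ht)
    _ = 2 * ε + t * (2 * ε) ^ 2 + Real.log (2 * N) / (t * n) := by simp

theorem integrable_expect_apply (hg : BoundedFamily g S K) (hP : Measurable P)
    (hPS : ∀ b, P b ∈ S) : Integrable (fun b => 𝔼 i, g (b i) (P b)) (sampleLaw ν n) := by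
  have := hg.measurable
  exact integrable_of_abs_le (by fun_prop) fun b =>
    abs_expect_le_of_abs_le Finset.univ_nonempty fun i => hg.bounded (b i) _ (hPS b)

theorem integrable_empiricalDeviation (hg : BoundedFamily g S K) (hP : Measurable P)
    (hPS : ∀ b, P b ∈ S) : Integrable (empiricalDeviation ν g P) (sampleLaw ν n) :=
  (hg.integrable_expect_apply hP hPS).sub (hg.integrable_integral_apply hP hPS)

/-- Jensen's inequality for the average over an independent second sample. -/
theorem integral_abs_empiricalDeviation_le_integral_abs_sampleDiff (hg : BoundedFamily g S K)
    (hP : Measurable P) (hPS : ∀ b, P b ∈ S) :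
    ∫ b, |empiricalDeviation ν g P b| ∂sampleLaw ν n
      ≤ ∫ z, |𝔼 i, sampleDiff g P z i| ∂(sampleLaw ν n).prod (sampleLaw ν n) := by
  have h_int := (hg.integrable_expect_sampleDiff (ν := ν) hP hPS).abs
  rw [integral_prod _ h_int]
  refine integral_mono (hg.integrable_empiricalDeviation hP hPS).abs h_int.integral_prod_left
    fun b => ?_
  have second_sample : empiricalDeviation ν g P b
      = ∫ b', 𝔼 i, sampleDiff g P (b, b') i ∂sampleLaw ν n := by
    have h_apply := hg.integrable_apply (ν := ν) (hPS b)
    simp only [empiricalDeviation, sampleDiff, Finset.expect_sub_distrib]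
    rw [integral_sub (integrable_const _)
      (integrable_expect fun i _ => integrable_comp_eval (μ := fun _ => ν) h_apply),
      integral_expect_sampleLaw h_apply, integral_const, probReal_univ, one_smul]
  rw [second_sample]
  exact abs_integral_le_integral_abs

theorem integral_expect_sampleDiff_sq_le (hg : BoundedFamily g S K) (hP : Measurable P)
    (hPS : ∀ b, P b ∈ S) :
    ∫ z, 𝔼 i, sampleDiff g P z i ^ 2 ∂(sampleLaw ν n).prod (sampleLaw ν n)
      ≤ 2 * (∫ b, 𝔼 i, g (b i) (P b) ^ 2 ∂sampleLaw ν n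
        + ∫ b, ∫ x, g x (P b) ^ 2 ∂ν ∂sampleLaw ν n) := by
  have := hg.measurable
  have first_int : Integrable (fun z : (Fin n → 𝓑) × (Fin n → 𝓑) => 𝔼 i, g (z.1 i) (P z.1) ^ 2)
      ((sampleLaw ν n).prod (sampleLaw ν n)) := (hg.sq.integrable_expect_apply hP hPS).comp_fst _
  have second_int : Integrable
      (fun z : (Fin n → 𝓑) × (Fin n → 𝓑) => 𝔼 i, g (z.2 i) (P z.1) ^ 2)
      ((sampleLaw ν n).prod (sampleLaw ν n)) :=
    integrable_of_abs_le (by fun_prop) fun z =>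
      abs_expect_le_of_abs_le Finset.univ_nonempty fun i => hg.sq.bounded (z.2 i) _ (hPS z.1)
  calc ∫ z, 𝔼 i, sampleDiff g P z i ^ 2 ∂(sampleLaw ν n).prod (sampleLaw ν n)
      ≤ ∫ z, 2 * (𝔼 i, g (z.1 i) (P z.1) ^ 2 + 𝔼 i, g (z.2 i) (P z.1) ^ 2)
          ∂(sampleLaw ν n).prod (sampleLaw ν n) := by
        refine integral_mono (hg.integrable_expect_sampleDiff_sq hP hPS)
          ((first_int.add second_int).const_mul 2) fun z => ?_
        dsimp only
        rw [← Finset.expect_add_distrib, Finset.mul_expect]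
        refine Finset.expect_le_expect fun i _ => ?_
        rw [sampleDiff]
        nlinarith [sq_nonneg (g (z.1 i) (P z.1) + g (z.2 i) (P z.1))]
    _ = 2 * (∫ b, 𝔼 i, g (b i) (P b) ^ 2 ∂sampleLaw ν n
          + ∫ b, ∫ x, g x (P b) ^ 2 ∂ν ∂sampleLaw ν n) := by
        rw [integral_const_mul, integral_add first_int second_int, integral_prod _ first_int,
          integral_prod _ second_int]
        simp only [integral_const, probReal_univ, one_smul,
          fun b => integral_expect_sampleLaw (n := n) (hg.sq.integrable_apply (ν := ν) (hPS b))]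

/-- The second moments of `g` at the computed index enter with the free factor `t`: this is what
turns small second moments into a fast rate. -/
theorem integral_abs_empiricalDeviation_le (hg : BoundedFamily g S K) (hP : Measurable P)
    (hPS : ∀ b, P b ∈ S) (hε : 0 ≤ ε)
    (hcov : EmpiricalCover ((fun p b => g b p) '' S) (n + n) N ε) (ht : 0 < t) :
    ∫ b, |empiricalDeviation ν g P b| ∂sampleLaw ν n
      ≤ 2 * t * (∫ b, 𝔼 i, g (b i) (P b) ^ 2 ∂sampleLaw ν n
          + ∫ b, ∫ x, g x (P b) ^ 2 ∂ν ∂sampleLaw ν n)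
        + (2 * ε + t * (2 * ε) ^ 2 + Real.log (2 * N) / (t * n)) := by
  have offset := hg.integral_offsetDeviation_le (ν := ν) hP hPS hε hcov ht
  simp only [offsetDeviation] at offset
  rw [integral_sub (hg.integrable_expect_sampleDiff hP hPS).abs
    ((hg.integrable_expect_sampleDiff_sq hP hPS).const_mul t), integral_const_mul] at offset
  have second_moment := mul_le_mul_of_nonneg_left
    (hg.integral_expect_sampleDiff_sq_le (ν := ν) hP hPS) ht.le
  linarith [hg.integral_abs_empiricalDeviation_le_integral_abs_sampleDiff (ν := ν) hP hPS]

end BoundedFamily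

end Symmetrization

/-! ### Rates in mean -/

section RatesInMean

open Asymptotics

variable {α : ℕ → Type*} [∀ n, MeasurableSpace (α n)] {μ : ∀ n, Measure (α n)}
  {E F G : Type*} [NormedAddCommGroup E] [NormedAddCommGroup F] [NormedAddCommGroup G]
  {T T' : ∀ n, α n → E} {U : ∀ n, α n → F} {r : ℕ → ℝ}

/-- `E‖T n‖ = o(r n)`, for random vectors that may live on different probability spaces. -/
structure LittleOInMean (μ : ∀ n, Measure (α n)) (T : ∀ n, α n → E) (r : ℕ → ℝ) : Prop where
  integrable : ∀ᶠ n in atTop, Integrable (T n) (μ n)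
  isLittleO : (fun n => ∫ a, ‖T n a‖ ∂μ n) =o[atTop] r

/-- `E‖T n‖ = O(r n)`, for random vectors that may live on different probability spaces. -/
structure BigOInMean (μ : ∀ n, Measure (α n)) (T : ∀ n, α n → E) (r : ℕ → ℝ) : Prop where
  integrable : ∀ᶠ n in atTop, Integrable (T n) (μ n)
  isBigO : (fun n => ∫ a, ‖T n a‖ ∂μ n) =O[atTop] r

theorem isBigO_integral_of_eventually_le {f g : ∀ n, α n → ℝ} (hf : ∀ n a, 0 ≤ f n a)
    (hg : ∀ᶠ n in atTop, Integrable (g n) (μ n)) (h : ∀ᶠ n in atTop, ∀ a, f n a ≤ g n a) :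
    (fun n => ∫ a, f n a ∂μ n) =O[atTop] fun n => ∫ a, g n a ∂μ n := by
  refine .of_norm_eventuallyLE ?_
  filter_upwards [hg, h] with n hg_int hle
  rw [Real.norm_of_nonneg (integral_nonneg (hf n))]
  exact integral_mono_of_nonneg (.of_forall (hf n)) hg_int (.of_forall hle)

namespace LittleOInMean

theorem bigO (hT : LittleOInMean μ T r) : BigOInMean μ T r := ⟨hT.integrable, hT.isLittleO.isBigO⟩

theorem norm (hT : LittleOInMean μ T r) : LittleOInMean μ (fun n a => ‖T n a‖) r :=
  ⟨hT.integrable.mono fun _ hn => hn.norm, by simpa only [norm_norm] using hT.isLittleO⟩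

theorem congr' (hT : LittleOInMean μ T r) (h : ∀ᶠ n in atTop, T n = T' n) :
    LittleOInMean μ T' r where
  integrable := by filter_upwards [hT.integrable, h] with n hn h_eq using h_eq ▸ hn
  isLittleO := hT.isLittleO.congr' (h.mono fun n hn => by simp only [hn]) .rfl

theorem mono {r' : ℕ → ℝ} (hT : LittleOInMean μ T r) (h : r =O[atTop] r') :
    LittleOInMean μ T r' :=
  ⟨hT.integrable, hT.isLittleO.trans_isBigO h⟩

theorem of_norm_le (hU : LittleOInMean μ U r)
    (hT : ∀ᶠ n in atTop, AEStronglyMeasurable (T n) (μ n)) {C : ℝ}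
    (h : ∀ᶠ n in atTop, ∀ a, ‖T n a‖ ≤ C * ‖U n a‖) : LittleOInMean μ T r where
  integrable := by
    filter_upwards [hU.integrable, hT, h] with n hU_int hT_meas hle
    exact (hU_int.norm.const_mul C).mono' hT_meas (.of_forall hle)
  isLittleO := by
    refine (isBigO_integral_of_eventually_le (fun _ _ => norm_nonneg _)
      (hU.integrable.mono fun n hn => hn.norm.const_mul C) h).trans_isLittleO ?_
    simp only [integral_const_mul]
    exact hU.isLittleO.const_mul_left C

theorem add (hT : LittleOInMean μ T r) (hT' : LittleOInMean μ T' r) :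
    LittleOInMean μ (fun n a => T n a + T' n a) r where
  integrable := by
    filter_upwards [hT.integrable, hT'.integrable] with n h h' using h.add h'
  isLittleO := by
    refine (isBigO_integral_of_eventually_le (g := fun n a => ‖T n a‖ + ‖T' n a‖)
      (fun _ _ => norm_nonneg _) ?_ (.of_forall fun _ _ => norm_add_le _ _)).trans_isLittleO
      ((hT.isLittleO.add hT'.isLittleO).congr' ?_ .rfl)
    · filter_upwards [hT.integrable, hT'.integrable] with n h h' using h.norm.add h'.norm
    · filter_upwards [hT.integrable, hT'.integrable] with n h h'
      exact (integral_add h.norm h'.norm).symm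

theorem clm_apply [NormedSpace ℝ E] [NormedSpace ℝ F] (hT : LittleOInMean μ T r) (φ : E →L[ℝ] F) :
    LittleOInMean μ (fun n a => φ (T n a)) r :=
  hT.of_norm_le (hT.integrable.mono fun _ hn => (φ.integrable_comp hn).aestronglyMeasurable)
    (.of_forall fun _ _ => φ.le_opNorm _)

theorem neg (hT : LittleOInMean μ T r) : LittleOInMean μ (fun n a => -T n a) r :=
  hT.of_norm_le (hT.integrable.mono fun _ hn => hn.neg.aestronglyMeasurable) (C := 1)
    (.of_forall fun _ _ => by rw [norm_neg, one_mul])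

theorem sub (hT : LittleOInMean μ T r) (hT' : LittleOInMean μ T' r) :
    LittleOInMean μ (fun n a => T n a - T' n a) r := by
  simpa only [sub_eq_add_neg] using hT.add hT'.neg

theorem finset_sum {ι : Type*} {s : Finset ι} {V : ι → ∀ n, α n → E}
    (hV : ∀ i ∈ s, LittleOInMean μ (V i) r) : LittleOInMean μ (fun n a => ∑ i ∈ s, V i n a) r := by
  classical
  induction s using Finset.induction_on with
  | empty =>
    simp only [Finset.sum_empty]
    exact ⟨.of_forall fun n => integrable_zero _ _ _, by simp⟩
  | insert i s hi ih =>
    simp only [Finset.sum_insert hi]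
    exact (hV i (s.mem_insert_self i)).add (ih fun j hj => hV j (Finset.mem_insert_of_mem hj))

theorem of_apply {J : ℕ} {T : ∀ n, α n → RJ J} (hT : ∀ j, LittleOInMean μ (fun n a => T n a j) r) :
    LittleOInMean μ T r := by
  have h := finset_sum (s := Finset.univ) fun j _ =>
    (hT j).clm_apply ((ContinuousLinearMap.id ℝ ℝ).smulRight (EuclideanSpace.single j (1 : ℝ)))
  convert h using 3 with n a
  ext j
  simp [Finset.sum_apply, Pi.single_apply]

theorem of_bounded [∀ n, IsProbabilityMeasure (μ n)] {T : ∀ n, α n → E} {K : ℝ}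
    (hT : ∀ᶠ n in atTop, AEStronglyMeasurable (T n) (μ n))
    (hK : ∀ᶠ n in atTop, ∀ a, ‖T n a‖ ≤ K) (hr : (fun _ => (1 : ℝ)) =o[atTop] r) :
    LittleOInMean μ T r :=
  of_norm_le (U := fun _ _ => (1 : ℝ)) ⟨.of_forall fun n => integrable_const _, by simpa using hr⟩
    hT (C := K) (by simpa using hK)

theorem of_forall_norm_le (hU : BigOInMean μ U r)
    (hT : ∀ᶠ n in atTop, AEStronglyMeasurable (T n) (μ n))
    (h : ∀ η : ℝ, 0 < η → ∃ V : ∀ n, α n → G, LittleOInMean μ V r ∧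
      ∀ᶠ n in atTop, ∀ a, ‖T n a‖ ≤ η * ‖U n a‖ + ‖V n a‖) : LittleOInMean μ T r := by
  have integrable_bound (η : ℝ) {V : ∀ n, α n → G} (hV : LittleOInMean μ V r) :
      ∀ᶠ n in atTop, Integrable (fun a => η * ‖U n a‖ + ‖V n a‖) (μ n) := by
    filter_upwards [hU.integrable, hV.integrable] with n hU_int hV_int
    exact (hU_int.norm.const_mul η).add hV_int.norm
  refine ⟨?_, isLittleO_iff.2 fun c hc => ?_⟩
  · obtain ⟨V, hV, hle⟩ := h 1 one_pos
    filter_upwards [integrable_bound 1 hV, hT, hle] with n h_int hT_meas hle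
    exact h_int.mono' hT_meas (.of_forall hle)
  obtain ⟨C, hC, hUr⟩ := hU.isBigO.exists_pos
  obtain ⟨V, hV, hle⟩ := h (c / (2 * C)) (by positivity)
  filter_upwards [hU.integrable, hV.integrable, integrable_bound _ hV, hle, hUr.bound,
    hV.isLittleO.bound (half_pos hc)] with n hU_int hV_int h_int hle hU_le hV_le
  rw [Real.norm_of_nonneg (integral_nonneg fun _ => norm_nonneg _)] at hU_le hV_le ⊢
  calc ∫ a, ‖T n a‖ ∂μ n
      ≤ ∫ a, (c / (2 * C) * ‖U n a‖ + ‖V n a‖) ∂μ n :=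
        integral_mono_of_nonneg (.of_forall fun _ => norm_nonneg _) h_int (.of_forall hle)
    _ = c / (2 * C) * ∫ a, ‖U n a‖ ∂μ n + ∫ a, ‖V n a‖ ∂μ n := by
        rw [integral_add (hU_int.norm.const_mul _) hV_int.norm, integral_const_mul]
    _ ≤ c / (2 * C) * (C * ‖r n‖) + c / 2 * ‖r n‖ := by gcongr
    _ = c * ‖r n‖ := by field_simp; ring

end LittleOInMean

namespace BigOInMean

theorem norm (hT : BigOInMean μ T r) : BigOInMean μ (fun n a => ‖T n a‖) r :=
  ⟨hT.integrable.mono fun _ hn => hn.norm, by simpa only [norm_norm] using hT.isBigO⟩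

theorem add (hT : BigOInMean μ T r) (hT' : BigOInMean μ T' r) :
    BigOInMean μ (fun n a => T n a + T' n a) r where
  integrable := by
    filter_upwards [hT.integrable, hT'.integrable] with n h h' using h.add h'
  isBigO := by
    refine (isBigO_integral_of_eventually_le (g := fun n a => ‖T n a‖ + ‖T' n a‖)
      (fun _ _ => norm_nonneg _) ?_ (.of_forall fun _ _ => norm_add_le _ _)).trans
      ((hT.isBigO.add hT'.isBigO).congr' ?_ .rfl)
    · filter_upwards [hT.integrable, hT'.integrable] with n h h' using h.norm.add h'.norm
    · filter_upwards [hT.integrable, hT'.integrable] with n h h'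
      exact (integral_add h.norm h'.norm).symm

end BigOInMean

end RatesInMean

/-! ### Empirical deviations at a data-dependent index -/

section EmpiricalDeviations

open Asymptotics

theorem isLittleO_natCast_rpow {s t : ℝ} (h : s < t) :
    (fun n : ℕ => (n : ℝ) ^ s) =o[atTop] fun n : ℕ => (n : ℝ) ^ t := by
  have h_zero := (tendsto_rpow_neg_atTop (sub_pos.2 h)).comp tendsto_natCast_atTop_atTop
  refine isLittleO_of_tendsto' ?_ (h_zero.congr' ?_)
  · filter_upwards [eventually_gt_atTop 0] with n hn h0
    exact absurd h0 (by positivity)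
  · filter_upwards [eventually_gt_atTop 0] with n hn
    rw [Function.comp_apply, neg_sub, Real.rpow_sub (by positivity)]

/-- The terms of the symmetrization bound that do not involve second moments, for nets of radius
`c / n` and of cardinality `C n ^ h`, with the weight `t = n ^ (-β)`. -/
theorem isLittleO_symmetrization_remainder {α β : ℝ} (hα : α < 1) (hβ : 0 ≤ β) (hαβ : α + β < 1)
    {C : ℝ} (hC : 0 < C) (h c : ℝ) :
    (fun n : ℕ => 2 * (c / n) + (n : ℝ) ^ (-β) * (2 * (c / n)) ^ 2
      + Real.log (2 * (C * (n : ℝ) ^ h)) / ((n : ℝ) ^ (-β) * n))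
      =o[atTop] fun n : ℕ => (n : ℝ) ^ (-α) := by
  have h_log : (fun n : ℕ => (n : ℝ) ^ (β - 1) * Real.log n)
      =o[atTop] fun n : ℕ => (n : ℝ) ^ (-α) := by
    have := (isBigO_refl (fun n : ℕ => (n : ℝ) ^ (β - 1)) atTop).mul_isLittleO
      ((isLittleO_log_rpow_atTop (r := 1 - α - β) (by linarith)).comp_tendsto
        tendsto_natCast_atTop_atTop)
    refine this.congr' .rfl ?_
    filter_upwards [eventually_gt_atTop 0] with n hn
    simp only [Function.comp_apply]
    rw [← Real.rpow_add (by positivity)]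
    congr 1
    ring
  have h_sum := (((isLittleO_natCast_rpow (s := -1) (t := -α) (by linarith)).const_mul_left
    (2 * c)).add ((isLittleO_natCast_rpow (s := -β - 2) (t := -α) (by linarith)).const_mul_left
    (4 * c ^ 2))).add (((isLittleO_natCast_rpow (s := β - 1) (t := -α) (by linarith)).const_mul_left
    (Real.log (2 * C))).add (h_log.const_mul_left h))
  refine h_sum.congr' ?_ .rfl
  filter_upwards [eventually_gt_atTop 0] with n hn
  have hn' : (0 : ℝ) < n := Nat.cast_pos.2 hn
  have log_eq : Real.log (2 * (C * (n : ℝ) ^ h)) = Real.log (2 * C) + h * Real.log n := by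
    rw [← mul_assoc, Real.log_mul (by positivity) (by positivity), Real.log_rpow hn']
  rw [log_eq, Real.rpow_sub hn', Real.rpow_sub hn', Real.rpow_neg_one, Real.rpow_neg hn'.le,
    Real.rpow_one, Real.rpow_ofNat]
  field_simp
  ring

variable {𝓑 Θ : Type*} [MeasurableSpace 𝓑] [MeasurableSpace Θ] {g : 𝓑 → Θ → ℝ} {S : Set Θ} {K : ℝ}

/-- A jointly measurable family of functions `g · p` that, for `p ∈ S`, is bounded by `K` and has
polynomial empirical covering numbers. -/
structure CoveredFamily (g : 𝓑 → Θ → ℝ) (S : Set Θ) (K : ℝ) : Prop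
    extends BoundedFamily g S K where
  covers : PolynomialCovers ((fun p b => g b p) '' S)

namespace CoveredFamily

theorem sub_apply (hg : CoveredFamily g S K) {p₀ : Θ} (hp₀ : p₀ ∈ S) :
    CoveredFamily (fun b p => g b p - g b p₀) S (2 * K) where
  measurable := have := hg.measurable; by unfold Function.uncurry; fun_prop
  bounded b p hp := by
    linarith [abs_sub (g b p) (g b p₀), hg.bounded b p hp, hg.bounded b p₀ hp₀]
  covers := by simpa only [Set.image_image] using hg.covers.sub_const fun b => g b p₀

theorem sq_sub_apply (hg : CoveredFamily g S K) {p₀ : Θ} (hp₀ : p₀ ∈ S) :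
    CoveredFamily (fun b p => (g b p - g b p₀) ^ 2) S ((2 * K) ^ 2) where
  toBoundedFamily := (hg.sub_apply hp₀).sq
  covers := by
    simpa only [Set.image_image] using hg.covers.sq_sub (K := K) (f₀ := fun b => g b p₀)
      (by rintro _ ⟨p, hp, rfl⟩ b; exact hg.bounded b p hp) fun b => hg.bounded b p₀ hp₀

variable {ν : Measure 𝓑} [IsProbabilityMeasure ν] {P : ∀ n, (Fin n → 𝓑) → Θ}

theorem littleOInMean_empiricalDeviation (hg : CoveredFamily g S K) (hP : ∀ n, Measurable (P n))
    (hPS : ∀ n [NeZero n] b, P n b ∈ S) {α β : ℝ} (hα : α < 1) (hβ : 0 ≤ β) (hαβ : α + β < 1)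
    (h_sample : LittleOInMean (sampleLaw ν) (fun n b => 𝔼 i, g (b i) (P n b) ^ 2)
      fun n => (n : ℝ) ^ (β - α))
    (h_pop : LittleOInMean (sampleLaw ν) (fun n b => ∫ x, g x (P n b) ^ 2 ∂ν)
      fun n => (n : ℝ) ^ (β - α)) :
    LittleOInMean (sampleLaw ν) (fun n => empiricalDeviation ν g (P n))
      fun n => (n : ℝ) ^ (-α) := by
  obtain ⟨C, h, c, hC, hc, hcov⟩ := hg.covers
  refine ⟨?_, ?_⟩
  · filter_upwards [eventually_gt_atTop 0] with n hn
    have : NeZero n := ⟨hn.ne'⟩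
    exact hg.integrable_empiricalDeviation (hP n) (hPS n)
  have second_moments : (fun n : ℕ => 2 * (n : ℝ) ^ (-β) *
      (∫ b, 𝔼 i, g (b i) (P n b) ^ 2 ∂sampleLaw ν n
        + ∫ b, ∫ x, g x (P n b) ^ 2 ∂ν ∂sampleLaw ν n)) =o[atTop] fun n => (n : ℝ) ^ (-α) := by
    have h_sum := h_sample.isLittleO.add h_pop.isLittleO
    simp only [Real.norm_of_nonneg (Finset.expect_nonneg fun _ _ => sq_nonneg _),
      Real.norm_of_nonneg (integral_nonneg fun _ => sq_nonneg _)] at h_sum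
    refine (((isBigO_refl (fun n : ℕ => (n : ℝ) ^ (-β)) atTop).const_mul_left 2).mul_isLittleO
      h_sum).congr' .rfl ?_
    filter_upwards [eventually_gt_atTop 0] with n hn
    rw [← Real.rpow_add (by positivity)]
    congr 1
    ring
  refine IsBigO.trans_isLittleO (.of_norm_eventuallyLE ?_)
    (second_moments.add (isLittleO_symmetrization_remainder hα hβ hαβ hC h c))
  filter_upwards [eventually_ge_atTop 2] with n hn
  have : NeZero n := ⟨by omega⟩
  have hn' : (2 : ℝ) ≤ n := by exact_mod_cast hn
  have hcov_n := hcov (n + n) (by omega) (1 / n) (by positivity)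
    (by rw [div_lt_one (by positivity)]; linarith)
  rw [one_div_one_div, mul_one_div] at hcov_n
  rw [Real.norm_of_nonneg (integral_nonneg fun _ => norm_nonneg _)]
  exact hg.integral_abs_empiricalDeviation_le (hP n) (hPS n) (by positivity) hcov_n (by positivity)

theorem littleOInMean_empiricalDeviation_of_lt_half (hg : CoveredFamily g S K)
    (hP : ∀ n, Measurable (P n)) (hPS : ∀ n [NeZero n] b, P n b ∈ S) {α : ℝ} (hα : α < 1 / 2) :
    LittleOInMean (sampleLaw ν) (fun n => empiricalDeviation ν g (P n))
      fun n => (n : ℝ) ^ (-α) := by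
  have one_isLittleO : (fun _ : ℕ => (1 : ℝ)) =o[atTop] fun n => (n : ℝ) ^ (1 / 2 - α) := by
    simpa only [Real.rpow_zero] using isLittleO_natCast_rpow (s := 0) (sub_pos.2 hα)
  refine hg.littleOInMean_empiricalDeviation hP hPS (β := 1 / 2) (by linarith) (by norm_num)
    (by linarith) (.of_bounded (K := K ^ 2) ?_ ?_ one_isLittleO)
    (.of_bounded (K := K ^ 2) ?_ ?_ one_isLittleO)
  all_goals
    filter_upwards [eventually_gt_atTop 0] with n hn
    have : NeZero n := ⟨hn.ne'⟩
  · exact (hg.sq.integrable_expect_apply (hP n) (hPS n)).aestronglyMeasurable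
  · exact fun b => abs_expect_le_of_abs_le Finset.univ_nonempty fun i =>
      hg.sq.bounded (b i) _ (hPS n b)
  · exact (hg.sq.integrable_integral_apply (hP n) (hPS n)).aestronglyMeasurable
  · exact fun b => hg.sq.abs_integral_le (hPS n b)

/-- Stochastic equicontinuity at `p₀`: a polynomial rate for the second moments of the increments
is upgraded by applying the crude rate to their squares. -/
theorem littleOInMean_empiricalDeviation_sub (hg : CoveredFamily g S K)
    (hP : ∀ n, Measurable (P n)) (hPS : ∀ n [NeZero n] b, P n b ∈ S) {p₀ : Θ} (hp₀ : p₀ ∈ S)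
    (h_pop : LittleOInMean (sampleLaw ν) (fun n b => ∫ x, (g x (P n b) - g x p₀) ^ 2 ∂ν)
      fun n => (n : ℝ) ^ (-(1 / 8) : ℝ)) :
    LittleOInMean (sampleLaw ν)
      (fun n => empiricalDeviation ν (fun x p => g x p - g x p₀) (P n))
      fun n => (n : ℝ) ^ (-(1 / 2) : ℝ) := by
  have h_sample := ((hg.sq_sub_apply hp₀).littleOInMean_empiricalDeviation_of_lt_half (ν := ν)
    hP hPS (α := 1 / 8) (by norm_num)).add h_pop
  simp only [empiricalDeviation, sub_add_cancel] at h_sample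
  have exponent : (3 / 8 - 1 / 2 : ℝ) = -(1 / 8) := by norm_num
  exact (hg.sub_apply hp₀).littleOInMean_empiricalDeviation hP hPS (β := 3 / 8) (by norm_num)
    (by norm_num) (by norm_num) (by rwa [exponent]) (by rwa [exponent])

end CoveredFamily

end EmpiricalDeviations

/-! ### Asymptotic linearity at clearing cutoffs -/

section Expect

variable {E F : Type*} [NormedAddCommGroup E] [NormedSpace ℝ E] [Module ℚ≥0 E]
  [NormedAddCommGroup F] [NormedSpace ℝ F] [Module ℚ≥0 F]

theorem expect_eq_smul_sum {n : ℕ} (v : Fin n → E) : 𝔼 i, v i = (1 / (n : ℝ)) • ∑ i, v i := by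
  rw [Finset.expect, ← NNRat.cast_smul_eq_nnqsmul ℝ, Finset.card_univ, Fintype.card_fin,
    NNRat.cast_inv, NNRat.cast_natCast, one_div]

theorem clm_expect {ι : Type*} (φ : E →L[ℝ] F) (s : Finset ι) (v : ι → E) :
    φ (𝔼 i ∈ s, v i) = 𝔼 i ∈ s, φ (v i) := by
  rw [Finset.expect, Finset.expect, map_nnrat_smul, map_sum]

theorem expect_apply {J : ℕ} {ι : Type*} (s : Finset ι) (v : ι → RJ J) (j : Fin J) :
    (𝔼 i ∈ s, v i) j = 𝔼 i ∈ s, v i j :=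
  clm_expect (EuclideanSpace.proj j) s v

theorem memLp_expect {α : Type*} [MeasurableSpace α] {μ : Measure α} [IsProbabilityMeasure μ]
    {n : ℕ} {q : ENNReal} {f : α → E} (hf : MemLp f q μ) :
    MemLp (fun b => 𝔼 i, f (b i)) q (sampleLaw μ n) := by
  simp only [expect_eq_smul_sum]
  exact (memLp_finsetSum _ fun i _ =>
    hf.comp_measurePreserving (measurePreserving_eval (fun _ => μ) i)).const_smul _

end Expect

section SecondMoments

variable {α : Type*} [MeasurableSpace α] {μ : Measure α} [IsProbabilityMeasure μ]

theorem sq_integral_le_integral_sq {f : α → ℝ} (hf : MemLp f 2 μ) :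
    (∫ a, f a ∂μ) ^ 2 ≤ ∫ a, f a ^ 2 ∂μ := by
  have := variance_nonneg f μ
  rwa [variance_eq_sub hf, sub_nonneg] at this

theorem integral_sq_expect_sub_integral_le {n : ℕ} [NeZero n] {f : α → ℝ} (hf : MemLp f 2 μ) :
    ∫ b, (𝔼 i, f (b i) - ∫ x, f x ∂μ) ^ 2 ∂sampleLaw μ n ≤ (∫ x, f x ^ 2 ∂μ) / n := by
  have hn : (n : ℝ) ≠ 0 := Nat.cast_ne_zero.2 (NeZero.ne n)
  have h_mean := integral_expect_sampleLaw (n := n) (hf.integrable one_le_two)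
  have h_var : Var[fun b => ∑ i : Fin n, f (b i); sampleLaw μ n] = n * Var[f; μ] := by
    simpa [Finset.sum_fn] using variance_sum_pi (μ := fun _ : Fin n => μ) fun _ => hf
  calc ∫ b, (𝔼 i, f (b i) - ∫ x, f x ∂μ) ^ 2 ∂sampleLaw μ n
      = Var[fun b => 𝔼 i, f (b i); sampleLaw μ n] := by
        rw [variance_eq_integral, h_mean]
        exact (memLp_expect hf).aemeasurable
    _ = Var[f; μ] / n := by
        simp only [Fintype.expect_eq_sum_div_card, Fintype.card_fin, div_eq_mul_inv]
        rw [variance_mul_const, h_var]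
        field_simp
    _ ≤ (∫ x, f x ^ 2 ∂μ) / n := by
        gcongr
        exact variance_le_expectation_sq hf.aestronglyMeasurable

theorem integral_sq_norm_expect_sub_integral_le {E : Type*} [NormedAddCommGroup E]
    [InnerProductSpace ℝ E] [FiniteDimensional ℝ E] [Module ℚ≥0 E] {n : ℕ} [NeZero n] {f : α → E}
    (hf : MemLp f 2 μ) :
    ∫ b, ‖𝔼 i, f (b i) - ∫ x, f x ∂μ‖ ^ 2 ∂sampleLaw μ n ≤ (∫ x, ‖f x‖ ^ 2 ∂μ) / n := by
  obtain ⟨φ, sq_norm_eq⟩ : ∃ φ : Fin (Module.finrank ℝ E) → E →L[ℝ] ℝ,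
      ∀ v, ‖v‖ ^ 2 = ∑ j, φ j v ^ 2 :=
    ⟨fun j => innerSL ℝ (stdOrthonormalBasis ℝ E j), fun v => by
      simpa using ((stdOrthonormalBasis ℝ E).sum_sq_norm_inner_right v).symm⟩
  have hφ (j) : MemLp (fun x => φ j (f x)) 2 μ := (φ j).comp_memLp' hf
  have deviation_memLp (j) :
      MemLp (fun b : Fin n → α => 𝔼 i, φ j (f (b i)) - ∫ x, φ j (f x) ∂μ) 2 (sampleLaw μ n) :=
    (memLp_expect (hφ j)).sub (memLp_const _)
  have h_integral (j) : φ j (∫ x, f x ∂μ) = ∫ x, φ j (f x) ∂μ :=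
    ((φ j).integral_comp_comm (hf.integrable one_le_two)).symm
  simp only [sq_norm_eq, map_sub, clm_expect, h_integral]
  rw [integral_finsetSum _ fun j _ => (deviation_memLp j).integrable_sq,
    integral_finsetSum _ fun j _ => (hφ j).integrable_sq, Finset.sum_div]
  exact Finset.sum_le_sum fun j _ => integral_sq_expect_sub_integral_le (hφ j)

end SecondMoments

section MeanDeviations

open Asymptotics

theorem BigOInMean.of_integral_sq_norm {α : ℕ → Type*} [∀ n, MeasurableSpace (α n)]
    {μ : ∀ n, Measure (α n)} [∀ n, IsProbabilityMeasure (μ n)] {E : Type*} [NormedAddCommGroup E]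
    {T : ∀ n, α n → E} {r : ℕ → ℝ} (hT : ∀ᶠ n in atTop, MemLp (T n) 2 (μ n))
    (h : (fun n => ∫ a, ‖T n a‖ ^ 2 ∂μ n) =O[atTop] fun n => r n ^ 2) : BigOInMean μ T r where
  integrable := hT.mono fun n hn => hn.integrable one_le_two
  isBigO := by
    refine IsBigO.of_pow two_ne_zero (IsBigO.trans (.of_norm_eventuallyLE ?_) h)
    filter_upwards [hT] with n hn
    rw [Pi.pow_apply, Real.norm_of_nonneg (sq_nonneg _)]
    exact sq_integral_le_integral_sq hn.norm

variable {α : Type*} [MeasurableSpace α] {μ : Measure α} [IsProbabilityMeasure μ]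
  {E : Type*} [NormedAddCommGroup E] [InnerProductSpace ℝ E] [FiniteDimensional ℝ E] [Module ℚ≥0 E]
  {f : α → E}

theorem isBigO_integral_sq_norm_expect_sub_integral (hf : MemLp f 2 μ) :
    (fun n : ℕ => ∫ b : Fin n → α, ‖𝔼 i, f (b i) - ∫ x, f x ∂μ‖ ^ 2 ∂sampleLaw μ n)
      =O[atTop] fun n : ℕ => (n : ℝ)⁻¹ := by
  refine .of_bound (∫ x, ‖f x‖ ^ 2 ∂μ) ?_
  filter_upwards [eventually_gt_atTop 0] with n hn
  have : NeZero n := ⟨hn.ne'⟩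
  rw [Real.norm_of_nonneg (integral_nonneg fun b => sq_nonneg _),
    Real.norm_of_nonneg (by positivity), ← div_eq_mul_inv]
  exact integral_sq_norm_expect_sub_integral_le hf

theorem bigOInMean_expect_sub_integral (hf : MemLp f 2 μ) :
    BigOInMean (sampleLaw μ) (fun n b => 𝔼 i : Fin n, f (b i) - ∫ x, f x ∂μ)
      fun n => (n : ℝ) ^ (-(1 / 2) : ℝ) := by
  refine .of_integral_sq_norm (.of_forall fun n => (memLp_expect hf).sub (memLp_const _)) ?_
  refine (isBigO_integral_sq_norm_expect_sub_integral hf).congr_right fun n => ?_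
  rw [← Real.rpow_natCast, ← Real.rpow_mul n.cast_nonneg]
  norm_num [Real.rpow_neg_one]

theorem littleOInMean_sq_norm_expect_sub_integral (hf : MemLp f 2 μ) :
    LittleOInMean (sampleLaw μ) (fun n b => ‖𝔼 i : Fin n, f (b i) - ∫ x, f x ∂μ‖ ^ 2)
      fun n => (n : ℝ) ^ (-(1 / 2) : ℝ) where
  integrable := .of_forall fun n =>
    ((memLp_expect hf).sub (memLp_const _)).integrable_norm_pow two_ne_zero
  isLittleO := by
    simp only [norm_pow, norm_norm]
    refine (isBigO_integral_sq_norm_expect_sub_integral hf).trans_isLittleO ?_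
    simpa only [Real.rpow_neg_one] using isLittleO_natCast_rpow (s := -1) (t := -(1 / 2))
      (by norm_num)

end MeanDeviations

section Remainder

open Asymptotics

variable {E F G : Type*} [NormedAddCommGroup E] [NormedAddCommGroup F] [NormedAddCommGroup G]

theorem exists_norm_le_of_isLittleO {ρ : E → F} {p₀ : E} {S : Set E} {K : ℝ} (hK : 0 ≤ K)
    (hρ : ρ =o[𝓝 p₀] fun p => p - p₀) (hρK : ∀ p ∈ S, ‖ρ p‖ ≤ K) {η : ℝ} (hη : 0 < η) :
    ∃ C, ∀ v b : ℝ, 0 ≤ v → 0 ≤ b → ∀ p ∈ S, ‖p - p₀‖ ≤ v + b →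
      ‖ρ p‖ ≤ η * (v + b) + C * (v + b ^ 2) := by
  obtain ⟨δ, hδ, hball⟩ := Metric.eventually_nhds_iff.1 (hρ.bound hη)
  have hC : 0 ≤ 2 * K / δ + 4 * K / δ ^ 2 := by positivity
  refine ⟨2 * K / δ + 4 * K / δ ^ 2, fun v b hv hb p hp hle => ?_⟩
  rcases lt_or_ge ‖p - p₀‖ δ with h_near | h_far
  · have := hball (by rwa [dist_eq_norm])
    nlinarith [mul_le_mul_of_nonneg_left hle hη.le, mul_nonneg hC (add_nonneg hv (sq_nonneg b))]
  have hK_le : K ≤ (2 * K / δ + 4 * K / δ ^ 2) * (v + b ^ 2) := by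
    rcases le_total (δ / 2) v with hv' | hb'
    · calc K = 2 * K / δ * (δ / 2) := by field_simp
        _ ≤ _ := by gcongr <;> nlinarith [sq_nonneg b, show 0 ≤ 4 * K / δ ^ 2 by positivity]
    · calc K = 4 * K / δ ^ 2 * (δ / 2) ^ 2 := by field_simp; ring
        _ ≤ _ := by
          gcongr
          · exact le_add_of_nonneg_left (by positivity)
          · nlinarith
  linarith [hρK p hp, mul_nonneg hη.le (add_nonneg hv hb)]

theorem LittleOInMean.comp_of_isLittleO {α : ℕ → Type*} [∀ n, MeasurableSpace (α n)]
    {μ : ∀ n, Measure (α n)} {ρ : E → F} {p₀ : E} {S : Set E} {K : ℝ} {r : ℕ → ℝ}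
    {P : ∀ n, α n → E} {V B : ∀ n, α n → G} (hK : 0 ≤ K)
    (hρ : ρ =o[𝓝 p₀] fun p => p - p₀) (hρK : ∀ p ∈ S, ‖ρ p‖ ≤ K)
    (hρP : ∀ᶠ n in atTop, AEStronglyMeasurable (fun a => ρ (P n a)) (μ n))
    (hPS : ∀ᶠ n in atTop, ∀ a, P n a ∈ S) (hV : LittleOInMean μ V r) (hB : BigOInMean μ B r)
    (hB_sq : LittleOInMean μ (fun n a => ‖B n a‖ ^ 2) r)
    (hP : ∀ᶠ n in atTop, ∀ a, ‖P n a - p₀‖ ≤ ‖V n a‖ + ‖B n a‖) :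
    LittleOInMean μ (fun n a => ρ (P n a)) r := by
  refine .of_forall_norm_le (G := ℝ) (hV.norm.bigO.add hB.norm) hρP fun η hη => ?_
  obtain ⟨C, hC⟩ := exists_norm_le_of_isLittleO hK hρ hρK hη
  refine ⟨fun n a => C * (‖V n a‖ + ‖B n a‖ ^ 2),
    (hV.norm.add hB_sq).clm_apply (ContinuousLinearMap.lsmul ℝ ℝ C), ?_⟩
  filter_upwards [hPS, hP] with n hn hP a
  refine (hC _ _ (norm_nonneg _) (norm_nonneg _) _ (hn a) (hP a)).trans ?_
  rw [Real.norm_of_nonneg (by positivity : 0 ≤ ‖V n a‖ + ‖B n a‖)]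
  gcongr
  exact Real.le_norm_self _

end Remainder

section ClearingSequences

variable {𝓑 : Type*} [MeasurableSpace 𝓑] {J : ℕ}

/-- Cutoffs `P n`, computed from samples with law `ν`, that clear the market up to `o(n^(-1/2))` in
mean, when `p₀` is a stable equilibrium of the market with the population `ν`. -/
structure ClearingSequence (ν : Measure 𝓑) (d : 𝓑 → RJ J → RJ J) (y : 𝓑 → RJ J → ℝ) (cap : RJ J)
    (S : Set (RJ J)) (P : ∀ n, (Fin n → 𝓑) → RJ J) (p₀ : RJ J) (K : ℝ) : Prop where
  measurable_demand : Measurable (Function.uncurry d)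
  norm_demand_le : ∀ b, ∀ p ∈ S, ‖d b p‖ ≤ K
  covers_demand : ∀ j, PolynomialCovers ((fun p b => d b p j) '' S)
  outcome : CoveredFamily y S K
  measurable_cutoff : ∀ n, Measurable (P n)
  cutoff_mem : ∀ n [NeZero n] b, P n b ∈ S
  base_mem : p₀ ∈ S
  holder : ∃ L, ∀ p ∈ S, (∀ j, ∫ x, (d x p j - d x p₀ j) ^ 2 ∂ν ≤ L * ‖p - p₀‖) ∧
    ∫ x, (y x p - y x p₀) ^ 2 ∂ν ≤ L * ‖p - p₀‖
  clears : LittleOInMean (sampleLaw ν) (fun n b => 𝔼 i, d (b i) (P n b) - cap)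
    fun n => (n : ℝ) ^ (-(1 / 2) : ℝ)
  stable : ∃ κ : ℝ, ∀ p ∈ S, ‖p - p₀‖ ≤ κ * ‖∫ x, d x p ∂ν - cap‖

theorem empiricalDeviation_apply {Θ : Type*} {ν : Measure 𝓑} {g : 𝓑 → Θ → RJ J} {n : ℕ}
    {P : (Fin n → 𝓑) → Θ} {b : Fin n → 𝓑} (hg : Integrable (g · (P b)) ν) (j : Fin J) :
    empiricalDeviation ν g P b j = empiricalDeviation ν (fun x p => g x p j) P b := by
  rw [empiricalDeviation, PiLp.sub_apply, expect_apply,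
    eval_integral_piLp (integrable_piLp_iff.1 hg), empiricalDeviation]

theorem LittleOInMean.empiricalDeviation_of_apply {Θ : Type*} {S : Set Θ} {ν : Measure 𝓑}
    {g : 𝓑 → Θ → RJ J} {P : ∀ n, (Fin n → 𝓑) → Θ} {r : ℕ → ℝ}
    (hg : ∀ p ∈ S, Integrable (g · p) ν) (hPS : ∀ n [NeZero n] b, P n b ∈ S)
    (h : ∀ j, LittleOInMean (sampleLaw ν)
      (fun n => empiricalDeviation ν (fun x p => g x p j) (P n)) r) :
    LittleOInMean (sampleLaw ν) (fun n => empiricalDeviation ν g (P n)) r := by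
  refine .of_apply fun j => (h j).congr' ?_
  filter_upwards [eventually_gt_atTop 0] with n hn
  have : NeZero n := ⟨hn.ne'⟩
  ext b
  exact (empiricalDeviation_apply (hg _ (hPS n b)) j).symm

namespace ClearingSequence

variable {ν : Measure 𝓑} {d : 𝓑 → RJ J → RJ J} {y : 𝓑 → RJ J → ℝ}
  {cap : RJ J} {S : Set (RJ J)} {P : ∀ n, (Fin n → 𝓑) → RJ J} {p₀ : RJ J} {K : ℝ}

theorem demand (H : ClearingSequence ν d y cap S P p₀ K) (j : Fin J) :
    CoveredFamily (fun b p => d b p j) S K where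
  measurable := (EuclideanSpace.proj (𝕜 := ℝ) j).measurable.comp H.measurable_demand
  bounded b p hp := (PiLp.norm_apply_le _ j).trans (H.norm_demand_le b p hp)
  covers := H.covers_demand j

variable [IsProbabilityMeasure ν]

theorem memLp_demand (H : ClearingSequence ν d y cap S P p₀ K) {p : RJ J} (hp : p ∈ S) :
    MemLp (d · p) 2 ν :=
  .of_bound (H.measurable_demand.comp measurable_prodMk_right).aestronglyMeasurable K
    (.of_forall fun b => H.norm_demand_le b p hp)

theorem integrable_demand (H : ClearingSequence ν d y cap S P p₀ K) {p : RJ J} (hp : p ∈ S) :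
    Integrable (d · p) ν := (H.memLp_demand hp).integrable one_le_two

theorem measurable_integral_demand (H : ClearingSequence ν d y cap S P p₀ K) :
    Measurable fun p => ∫ x, d x p ∂ν :=
  (H.measurable_demand.comp measurable_swap).stronglyMeasurable.integral_prod_right'.measurable

theorem norm_integral_demand_le (H : ClearingSequence ν d y cap S P p₀ K) {p : RJ J} (hp : p ∈ S) :
    ‖∫ x, d x p ∂ν‖ ≤ K := by
  simpa using norm_integral_le_of_norm_le_const (μ := ν) (f := (d · p))
    (.of_forall fun b => H.norm_demand_le b p hp)

theorem littleOInMean_cutoff_sub (H : ClearingSequence ν d y cap S P p₀ K) :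
    LittleOInMean (sampleLaw ν) (fun n b => P n b - p₀) fun n => (n : ℝ) ^ (-(1 / 8) : ℝ) := by
  obtain ⟨κ, hκ⟩ := H.stable
  have deviation := LittleOInMean.empiricalDeviation_of_apply (ν := ν) (P := P)
    (fun p => H.integrable_demand) H.cutoff_mem fun j =>
      (H.demand j).littleOInMean_empiricalDeviation_of_lt_half H.measurable_cutoff H.cutoff_mem
        (show (1 / 8 : ℝ) < 1 / 2 by norm_num)
  have population_excess := (H.clears.mono (isLittleO_natCast_rpow
    (t := -(1 / 8)) (by norm_num)).isBigO).sub deviation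
  refine population_excess.of_norm_le
    (.of_forall fun n => ((H.measurable_cutoff n).sub_const p₀).aestronglyMeasurable) (C := κ) ?_
  filter_upwards [eventually_gt_atTop 0] with n hn b
  have : NeZero n := ⟨hn.ne'⟩
  have excess_eq : 𝔼 i, d (b i) (P n b) - cap - empiricalDeviation ν d (P n) b
      = ∫ x, d x (P n b) ∂ν - cap := by
    rw [empiricalDeviation]
    abel
  rw [excess_eq]
  exact hκ _ (H.cutoff_mem n b)

theorem littleOInMean_empiricalDeviation_sub (H : ClearingSequence ν d y cap S P p₀ K)
    {g : 𝓑 → RJ J → ℝ} {K' L : ℝ} (hg : CoveredFamily g S K')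
    (hL : ∀ p ∈ S, ∫ x, (g x p - g x p₀) ^ 2 ∂ν ≤ L * ‖p - p₀‖) :
    LittleOInMean (sampleLaw ν)
      (fun n => empiricalDeviation ν (fun x p => g x p - g x p₀) (P n))
      fun n => (n : ℝ) ^ (-(1 / 2) : ℝ) := by
  refine hg.littleOInMean_empiricalDeviation_sub H.measurable_cutoff H.cutoff_mem H.base_mem
    (H.littleOInMean_cutoff_sub.of_norm_le (.of_forall fun n =>
      ((hg.sq_sub_apply H.base_mem).measurable_integral.comp
        (H.measurable_cutoff n)).aestronglyMeasurable) (C := L) ?_)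
  filter_upwards [eventually_gt_atTop 0] with n hn b
  have : NeZero n := ⟨hn.ne'⟩
  rw [Real.norm_of_nonneg (integral_nonneg fun x => sq_nonneg _)]
  exact hL _ (H.cutoff_mem n b)

theorem littleOInMean_empiricalDeviation_demand_sub (H : ClearingSequence ν d y cap S P p₀ K) :
    LittleOInMean (sampleLaw ν)
      (fun n => empiricalDeviation ν (fun x p => d x p - d x p₀) (P n))
      fun n => (n : ℝ) ^ (-(1 / 2) : ℝ) := by
  obtain ⟨L, hL⟩ := H.holder
  exact .empiricalDeviation_of_apply
    (fun p hp => (H.integrable_demand hp).sub (H.integrable_demand H.base_mem)) H.cutoff_mem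
    fun j => H.littleOInMean_empiricalDeviation_sub (H.demand j) fun p hp => (hL p hp).1 j

theorem norm_cutoff_sub_le (H : ClearingSequence ν d y cap S P p₀ K) :
    ∃ κ : ℝ, ∀ n [NeZero n] b, ‖P n b - p₀‖
      ≤ ‖κ • (𝔼 i, d (b i) (P n b) - cap
          - empiricalDeviation ν (fun x p => d x p - d x p₀) (P n) b)‖
        + ‖κ • (𝔼 i, d (b i) p₀ - ∫ x, d x p₀ ∂ν)‖ := by
  obtain ⟨κ, hκ⟩ := H.stable
  refine ⟨κ, fun n _ b => (hκ _ (H.cutoff_mem n b)).trans ?_⟩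
  rw [norm_smul, norm_smul, ← mul_add]
  refine mul_le_mul (Real.le_norm_self κ) ?_ (norm_nonneg _) (norm_nonneg κ)
  refine le_trans (le_of_eq ?_) (norm_sub_le _ _)
  rw [empiricalDeviation, integral_sub (H.integrable_demand (H.cutoff_mem n b))
    (H.integrable_demand H.base_mem), Finset.expect_sub_distrib]
  congr 1
  abel

theorem littleOInMean_comp (H : ClearingSequence ν d y cap S P p₀ K) {ρ : RJ J → ℝ} {K' : ℝ}
    (hK' : 0 ≤ K') (hρ_meas : Measurable ρ) (hρK : ∀ p ∈ S, ‖ρ p‖ ≤ K')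
    (hρ : ρ =o[𝓝 p₀] fun p => p - p₀) :
    LittleOInMean (sampleLaw ν) (fun n b => ρ (P n b)) fun n => (n : ℝ) ^ (-(1 / 2) : ℝ) := by
  obtain ⟨κ, hκ⟩ := H.norm_cutoff_sub_le
  have base_memLp : MemLp (fun x => κ • d x p₀) 2 ν := (H.memLp_demand H.base_mem).const_smul κ
  have higher_order := (H.clears.sub H.littleOInMean_empiricalDeviation_demand_sub).clm_apply
    (ContinuousLinearMap.lsmul ℝ ℝ κ)
  have first_order := bigOInMean_expect_sub_integral base_memLp
  have first_order_sq := littleOInMean_sq_norm_expect_sub_integral base_memLp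
  simp only [integral_smul, ← Finset.smul_expect, ← smul_sub] at first_order first_order_sq
  simp only [ContinuousLinearMap.lsmul_apply] at higher_order
  refine higher_order.comp_of_isLittleO hK' hρ hρK
    (.of_forall fun n => (hρ_meas.comp (H.measurable_cutoff n)).aestronglyMeasurable) ?_
    first_order first_order_sq ?_
  all_goals
    filter_upwards [eventually_gt_atTop 0] with n hn b
    have : NeZero n := ⟨hn.ne'⟩
  · exact H.cutoff_mem n b
  · exact hκ n b

theorem littleOInMean_expect_outcome_sub (H : ClearingSequence ν d y cap S P p₀ K)
    {φ : RJ J →L[ℝ] ℝ}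
    (hφ : (fun p => ∫ x, y x p ∂ν - ∫ x, y x p₀ ∂ν - φ (∫ x, d x p ∂ν - ∫ x, d x p₀ ∂ν))
      =o[𝓝 p₀] fun p => p - p₀) :
    LittleOInMean (sampleLaw ν)
      (fun n b => 𝔼 i, y (b i) (P n b) - 𝔼 i, (y (b i) p₀ - φ (d (b i) p₀ - cap)))
      fun n => (n : ℝ) ^ (-(1 / 2) : ℝ) := by
  obtain ⟨L, hL⟩ := H.holder
  have h_outcome := H.littleOInMean_empiricalDeviation_sub H.outcome fun p hp => (hL p hp).2
  have h_demand := (H.clears.sub H.littleOInMean_empiricalDeviation_demand_sub).clm_apply φ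
  have h_remainder := H.littleOInMean_comp (K' := K + K + ‖φ‖ * (K + K)) ?_ ?_ ?_ hφ
  · refine ((h_outcome.add h_demand).add h_remainder).congr' ?_
    filter_upwards [eventually_gt_atTop 0] with n hn
    have : NeZero n := ⟨hn.ne'⟩
    ext b
    have mem := H.cutoff_mem n b
    simp only [empiricalDeviation, integral_sub (H.integrable_demand mem)
      (H.integrable_demand H.base_mem), integral_sub (H.outcome.integrable_apply mem)
      (H.outcome.integrable_apply H.base_mem), Finset.expect_sub_distrib, map_sub, clm_expect,
      Fintype.expect_const]
    ring
  · have := (norm_nonneg _).trans (H.norm_integral_demand_le H.base_mem)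
    positivity
  · exact (H.outcome.measurable_integral.sub_const _).sub
      (φ.measurable.comp (H.measurable_integral_demand.sub_const _))
  · intro p hp
    refine (norm_sub_le _ _).trans (add_le_add ((norm_sub_le _ _).trans ?_)
      ((φ.le_opNorm _).trans ?_))
    · exact add_le_add (H.outcome.abs_integral_le hp) (H.outcome.abs_integral_le H.base_mem)
    · gcongr
      exact (norm_sub_le _ _).trans (add_le_add (H.norm_integral_demand_le hp)
        (H.norm_integral_demand_le H.base_mem))

end ClearingSequence

end ClearingSequences

/-! ### Zeros and derivatives -/

section Zeros

open Asymptotics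

variable {E F : Type*} [NormedAddCommGroup E] [NormedAddCommGroup F]

theorem isBigO_principal_of_isCompact {X : Type*} [TopologicalSpace X] {S : Set X}
    (hS : IsCompact S) {f : X → E} {g : X → F} (h : ∀ x ∈ S, f =O[𝓝[S] x] g) : f =O[𝓟 S] g := by
  refine hS.induction_on (p := fun s => f =O[𝓟 s] g) ?_ (fun s t hst ht => ?_) (fun s t hs ht => ?_)
    fun x hx => ?_
  · simp only [principal_empty, isBigO_bot]
  · exact ht.mono (principal_mono.2 hst)
  · exact sup_principal (s := s) (t := t) ▸ hs.sup ht
  · obtain ⟨C, hC⟩ := (h x hx).bound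
    exact ⟨_, hC, .of_bound C (eventually_principal.2 fun _ => id)⟩

variable [NormedSpace ℝ E] [NormedSpace ℝ F] [FiniteDimensional ℝ E]

theorem isBigO_sub_principal_of_unique_zero {S : Set E} (hS : IsCompact S) {z : E → F}
    (hz : ContinuousOn z S) {p₀ : E} (hz₀ : z p₀ = 0) (h_unique : ∀ p ∈ S, z p = 0 → p = p₀)
    {D : E →L[ℝ] F} (hD : HasFDerivAt z D p₀) (hD_inj : Function.Injective D) :
    (fun p => p - p₀) =O[𝓟 S] z := by
  refine isBigO_principal_of_isCompact hS fun p hp => ?_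
  rcases eq_or_ne p p₀ with rfl | hne
  · have inducing : IsInducing D :=
      (LinearMap.isClosedEmbedding_of_injective (LinearMap.ker_eq_bot.2 hD_inj)).isInducing
    simpa only [hz₀, sub_zero] using
      ((hD.isTheta_sub inducing).symm.isBigO.mono nhdsWithin_le_nhds :
        (fun q => q - p) =O[𝓝[S] p] fun q => z q - z p)
  · have bounded : (fun q => q - p₀) =O[𝓝[S] p] fun _ => (1 : ℝ) :=
      (((continuous_id.sub continuous_const).tendsto p).isBigO_one ℝ).mono nhdsWithin_le_nhds
    refine bounded.trans ?_
    exact (isBigO_const_left_iff_pos_le_norm one_ne_zero).2 <| by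
      have hz_pos : 0 < ‖z p‖ := norm_pos_iff.2 fun h => hne (h_unique p hp h)
      refine ⟨‖z p‖ / 2, half_pos hz_pos, ?_⟩
      exact ((hz p hp).norm.eventually (lt_mem_nhds (half_lt_self hz_pos))).mono fun _ => le_of_lt

theorem isLittleO_sub_comp_inverse_fderiv {z : E → E} {u : E → F} {p₀ : E}
    (hz : DifferentiableAt ℝ z p₀) (hu : DifferentiableAt ℝ u p₀)
    (h_inj : Function.Injective (fderiv ℝ z p₀)) :
    (fun p => u p - u p₀ - ((fderiv ℝ u p₀).comp (fderiv ℝ z p₀).inverse) (z p - z p₀))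
      =o[𝓝 p₀] fun p => p - p₀ := by
  obtain ⟨e, he⟩ : (fderiv ℝ z p₀).IsInvertible :=
    ⟨(LinearEquiv.ofInjectiveEndo (fderiv ℝ z p₀).toLinearMap h_inj).toContinuousLinearEquiv, rfl⟩
  set φ := (fderiv ℝ u p₀).comp (fderiv ℝ z p₀).inverse with φ_def
  have φ_comp : φ.comp (fderiv ℝ z p₀) = fderiv ℝ u p₀ := by
    rw [φ_def, ← he, ContinuousLinearMap.inverse_equiv]
    ext v
    simp
  have h_deriv := hu.hasFDerivAt.sub (φ.hasFDerivAt.comp p₀ hz.hasFDerivAt)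
  rw [φ_comp, sub_self] at h_deriv
  refine h_deriv.isLittleO.congr_left fun p => ?_
  simp only [Pi.sub_apply, Function.comp_apply, zero_apply, map_sub]
  abel

end Zeros

section Smooth

variable {J : ℕ} {𝓧 : Type*} [MeasurableSpace 𝓧]

theorem sum_smul_single (v : RJ J) : ∑ j, v j • EuclideanSpace.single j (1 : ℝ) = v := by
  simpa using (EuclideanSpace.basisFun (Fin J) ℝ).sum_repr v

theorem opNorm_le_sum_norm_apply_single {F : Type*} [NormedAddCommGroup F] [NormedSpace ℝ F]
    (D : RJ J →L[ℝ] F) : ‖D‖ ≤ ∑ j, ‖D (EuclideanSpace.single j 1)‖ := by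
  refine D.opNorm_le_bound (by positivity) fun v => ?_
  conv_lhs => rw [← sum_smul_single v, map_sum]
  rw [Finset.sum_mul]
  refine norm_sum_le_of_le _ fun j _ => ?_
  rw [map_smul, norm_smul, mul_comm]
  gcongr
  exact PiLp.norm_apply_le v j

theorem SmoothBounded.differentiableAt {f : RJ J → ℝ} {U : Set (RJ J)} {c : ℝ} {p : RJ J}
    (hf : SmoothBounded f U c) (hU : IsOpen U) (hp : p ∈ U) : DifferentiableAt ℝ f p :=
  (hf.1.contDiffAt (hU.mem_nhds hp)).differentiableAt two_ne_zero

theorem SmoothBounded.norm_fderiv_le {f : RJ J → ℝ} {U : Set (RJ J)} {c : ℝ} {p : RJ J}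
    (hf : SmoothBounded f U c) (hp : p ∈ U) : ‖fderiv ℝ f p‖ ≤ J * c := by
  refine (opNorm_le_sum_norm_apply_single _).trans ?_
  simpa using Finset.sum_le_card_nsmul Finset.univ _ c fun j _ => (hf.2 p hp).1 j

theorem stronglyMeasurable_of_apply_single {D : 𝓧 → RJ J →L[ℝ] ℝ}
    (hD : ∀ j, Measurable fun x => D x (EuclideanSpace.single j 1)) : StronglyMeasurable D := by
  have D_eq : D = fun x => ∑ j,
      D x (EuclideanSpace.single j 1) • (EuclideanSpace.proj j : RJ J →L[ℝ] ℝ) := by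
    ext x v
    conv_lhs => rw [← sum_smul_single v, map_sum]
    simp [mul_comm]
  rw [D_eq]
  exact Finset.stronglyMeasurable_fun_sum _ fun j _ => (hD j).stronglyMeasurable.smul_const _

theorem measurable_fderiv_apply {E : Type*} [NormedAddCommGroup E] [NormedSpace ℝ E]
    {m : 𝓧 → E → ℝ} {p : E} {U : Set E} (hU : U ∈ 𝓝 p) (hm : ∀ q ∈ U, Measurable fun x => m x q)
    (hd : ∀ x, DifferentiableAt ℝ (m x) p) (v : E) : Measurable fun x => fderiv ℝ (m x) p v := by
  have inv_smul_tendsto : Tendsto (fun k : ℕ => p + (k : ℝ)⁻¹ • v) atTop (𝓝 p) := by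
    simpa using ((tendsto_inv_atTop_zero.comp
      (tendsto_natCast_atTop_atTop (R := ℝ))).smul_const v).const_add p
  obtain ⟨N, hN⟩ := eventually_atTop.1 (inv_smul_tendsto.eventually hU)
  have difference_quotients (x : 𝓧) : Tendsto (fun k : ℕ => ((k + N : ℕ) : ℝ) •
      (m x (p + ((k + N : ℕ) : ℝ)⁻¹ • v) - m x p)) atTop (𝓝 (fderiv ℝ (m x) p v)) :=
    (((hd x).hasFDerivAt.lim_real v).comp (tendsto_natCast_atTop_atTop (R := ℝ))).comp
      (tendsto_add_atTop_nat N)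
  refine measurable_of_tendsto_metrizable (fun k => ?_) (tendsto_pi_nhds.2 difference_quotients)
  exact ((hm _ (hN _ (Nat.le_add_left N k))).sub (hm p (mem_of_mem_nhds hU))).const_smul
    ((k + N : ℕ) : ℝ)

variable {Ω : Type*} [MeasurableSpace Ω] {μ : Measure Ω} {X : Ω → 𝓧}

theorem differentiableAt_integral_mul [IsFiniteMeasure μ] (hX : Measurable X) {ρ : 𝓧 → ℝ}
    (hρ : Measurable ρ) {R : ℝ} (hρR : ∀ x, ‖ρ x‖ ≤ R) {U : Set (RJ J)} (hU : IsOpen U) {p : RJ J}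
    (hp : p ∈ U) {m : 𝓧 → RJ J → ℝ} (hm : ∀ q ∈ U, Measurable fun x => m x q)
    (hm_int : Integrable (fun ω => m (X ω) p) μ) {c : ℝ} (hs : ∀ x, SmoothBounded (m x) U c) :
    DifferentiableAt ℝ (fun q => ∫ ω, ρ (X ω) * m (X ω) q ∂μ) p := by
  have fderiv_measurable : StronglyMeasurable fun x => fderiv ℝ (m x) p :=
    stronglyMeasurable_of_apply_single fun j => measurable_fderiv_apply (hU.mem_nhds hp) hm
      (fun x => (hs x).differentiableAt hU hp) _
  refine (hasFDerivAt_integral_of_dominated_of_fderiv_le (𝕜 := ℝ) (bound := fun _ => R * (J * c))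
    (F' := fun q ω => ρ (X ω) • fderiv ℝ (m (X ω)) q) (hU.mem_nhds hp) ?_
    (hm_int.bdd_mul (hρ.comp hX).aestronglyMeasurable (.of_forall fun ω => hρR _))
    ((hρ.comp hX).stronglyMeasurable.smul
      (fderiv_measurable.comp_measurable hX)).aestronglyMeasurable
    (.of_forall fun ω q hq => ?_) (integrable_const _)
    (.of_forall fun ω q hq =>
      ((hs (X ω)).differentiableAt hU hq).hasFDerivAt.const_mul (ρ (X ω)))).differentiableAt
  · filter_upwards [hU.mem_nhds hp] with q hq
    exact ((hρ.comp hX).mul ((hm q hq).comp hX)).aestronglyMeasurable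
  · rw [norm_smul]
    exact mul_le_mul (hρR _) ((hs _).norm_fderiv_le hq) (norm_nonneg _)
      ((norm_nonneg _).trans (hρR (X ω)))

theorem integral_mul_eq_of_condExp [IsFiniteMeasure μ] (hX : Measurable X) {ρ : 𝓧 → ℝ}
    (hρ : Measurable ρ) {f : Ω → ℝ} (hf : Integrable f μ)
    (hρf : Integrable (fun ω => ρ (X ω) * f ω) μ) {m : 𝓧 → ℝ}
    (hm : (fun ω => m (X ω)) =ᵐ[μ] μ[f | MeasurableSpace.comap X inferInstance]) :
    ∫ ω, ρ (X ω) * f ω ∂μ = ∫ ω, ρ (X ω) * m (X ω) ∂μ := by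
  rw [← integral_condExp hX.comap_le]
  refine integral_congr_ae ?_
  filter_upwards [hm, condExp_mul_of_stronglyMeasurable_left
    (hρ.comp (comap_measurable X)).stronglyMeasurable hρf hf] with ω h_version h_pull
  rw [h_version]
  exact h_pull

end Smooth

section Markov

open Asymptotics

variable {Ω : Type*} [MeasurableSpace Ω] {μ : Measure Ω} {T : ℕ → Ω → ℝ} {r : ℕ → ℝ}

theorem measureReal_le_norm_div_le {f : Ω → ℝ} (hf : Integrable f μ) {s ε : ℝ} (hs : 0 < s)
    (hε : 0 < ε) : μ.real {ω | ε ≤ ‖f ω / s‖} ≤ (∫ ω, ‖f ω‖ ∂μ) / s / ε := by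
  rw [le_div_iff₀ hε, le_div_iff₀ hs, mul_assoc, mul_comm]
  refine le_trans (le_of_eq ?_) (mul_meas_ge_le_integral_of_nonneg
    (.of_forall fun ω => norm_nonneg _) hf.norm (ε * s))
  simp only [norm_div, Real.norm_of_nonneg hs.le, le_div_iff₀ hs]

variable [IsFiniteMeasure μ]

theorem BigOInMean.boundedInProbability (hT : BigOInMean (fun _ => μ) T r)
    (hr : ∀ᶠ n in atTop, 0 < r n) : BoundedInProbability μ fun n ω => T n ω / r n := by
  intro ε hε
  obtain ⟨C, hC, hTC⟩ := hT.isBigO.exists_pos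
  refine ⟨C / ε, ?_⟩
  filter_upwards [hT.integrable, hr, hTC.bound] with n hn hrn hle
  rw [Real.norm_of_nonneg (integral_nonneg fun _ => norm_nonneg _), Real.norm_of_nonneg hrn.le]
    at hle
  rw [ENNReal.le_ofReal_iff_toReal_le (measure_ne_top _ _) hε.le]
  calc μ.real {ω | C / ε < |T n ω / r n|} ≤ μ.real {ω | C / ε ≤ ‖T n ω / r n‖} :=
        measureReal_mono fun ω (hω : C / ε < |T n ω / r n|) => hω.le
    _ ≤ (∫ ω, ‖T n ω‖ ∂μ) / r n / (C / ε) := measureReal_le_norm_div_le hn hrn (by positivity)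
    _ ≤ C / (C / ε) := by gcongr; exact (div_le_iff₀ hrn).2 hle
    _ = ε := by field_simp

theorem LittleOInMean.littleOInProbability (hT : LittleOInMean (fun _ => μ) T r)
    (hr : ∀ᶠ n in atTop, 0 < r n) : LittleOInProbability μ T r := by
  refine tendstoInMeasure_iff_measureReal_norm.2 fun ε hε => ?_
  have h_lim := (hT.isLittleO.tendsto_div_nhds_zero).div_const ε
  rw [zero_div] at h_lim
  refine squeeze_zero' (.of_forall fun n => measureReal_nonneg) ?_ h_lim
  filter_upwards [hT.integrable, hr] with n hn hrn
  simpa only [sub_zero] using measureReal_le_norm_div_le hn hrn hε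

end Markov

/-! ### The law of submissions under a treatment rule -/

section WeightedLaws

variable {Ω Ω' α : Type*} [MeasurableSpace Ω] [MeasurableSpace Ω'] [MeasurableSpace α]
  {μ : Measure Ω} {μ' : Measure Ω'} {ρ : Ω → ℝ} {Z : Ω → α} {ρ' : Ω' → ℝ} {Z' : Ω' → α}

/-- The law of `Z` when `ω` is weighted by `ρ ω ≥ 0`; with `ρ` the probability of a treatment, the
law of `Z` on the event that this treatment is drawn. -/
def weightedLaw (μ : Measure Ω) (ρ : Ω → ℝ) (Z : Ω → α) : Measure α :=
  (μ.withDensity fun ω => ENNReal.ofReal (ρ ω)).map Z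

theorem weightedLaw_apply (hZ : Measurable Z) {s : Set α} (hs : MeasurableSet s) :
    weightedLaw μ ρ Z s = ∫⁻ ω, s.indicator 1 (Z ω) * ENNReal.ofReal (ρ ω) ∂μ := by
  rw [weightedLaw, Measure.map_apply hZ hs, withDensity_apply _ (hZ hs),
    ← lintegral_indicator (hZ hs)]
  refine lintegral_congr fun ω => ?_
  by_cases hω : Z ω ∈ s <;> simp [hω]

theorem weightedLaw_univ (hZ : Measurable Z) :
    weightedLaw μ ρ Z Set.univ = ∫⁻ ω, ENNReal.ofReal (ρ ω) ∂μ := by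
  simp only [weightedLaw_apply hZ .univ, Set.indicator_univ, Pi.one_apply, one_mul]

theorem isFiniteMeasure_weightedLaw (hρ : Integrable ρ μ) :
    IsFiniteMeasure (weightedLaw μ ρ Z) := by
  have := isFiniteMeasure_withDensity_ofReal hρ.hasFiniteIntegral
  exact Measure.isFiniteMeasure_map _ Z

theorem weightedLaw_eq_of_identDistrib
    (h : IdentDistrib (fun ω => (ρ ω, Z ω)) (fun ω => (ρ' ω, Z' ω)) μ μ')
    (hZ : Measurable Z) (hZ' : Measurable Z') : weightedLaw μ ρ Z = weightedLaw μ' ρ' Z' := by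
  ext s hs
  rw [weightedLaw_apply hZ hs, weightedLaw_apply hZ' hs]
  have h_meas : Measurable fun t : ℝ × α => s.indicator 1 t.2 * ENNReal.ofReal t.1 :=
    ((measurable_one.indicator hs).comp measurable_snd).mul measurable_fst.ennreal_ofReal
  exact (h.comp h_meas).lintegral_eq

theorem weightedLaw_prod_eq_pi {ι : Type*} [Fintype ι] {ρ : ι → Ω → ℝ} {Z : ι → Ω → α}
    (h_indep : iIndepFun (fun i ω => (ρ i ω, Z i ω)) μ) (hρ : ∀ i, Measurable (ρ i))
    (hρ_nonneg : ∀ i ω, 0 ≤ ρ i ω) (hZ : ∀ i, Measurable (Z i))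
    [∀ i, SigmaFinite (weightedLaw μ (ρ i) (Z i))] :
    weightedLaw μ (fun ω => ∏ i, ρ i ω) (fun ω i => Z i ω)
      = Measure.pi fun i => weightedLaw μ (ρ i) (Z i) := by
  refine (Measure.pi_eq fun s hs => ?_).symm
  have h_meas : ∀ i, Measurable fun t : ℝ × α => (s i).indicator 1 t.2 * ENNReal.ofReal t.1 :=
    fun i => ((measurable_one.indicator (hs i)).comp measurable_snd).mul
      measurable_fst.ennreal_ofReal
  simp_rw [weightedLaw_apply (measurable_pi_lambda _ hZ) (MeasurableSet.univ_pi hs),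
    weightedLaw_apply (hZ _) (hs _)]
  refine Eq.trans (lintegral_congr fun ω => ?_)
    (lintegral_prod_eq_prod_lintegral_of_indepFun Finset.univ _ (h_indep.comp _ h_meas)
      fun i => (h_meas i).comp ((hρ i).prodMk (hZ i)))
  simp only [Finset.prod_mul_distrib, ← ENNReal.ofReal_prod_of_nonneg fun i _ => hρ_nonneg i ω,
    ← Set.indicator_pi_one_apply, Finset.coe_univ]

theorem pi_sum_eq_sum_pi {ι κ : Type*} [Fintype ι] [DecidableEq ι] [Fintype κ]
    (ν : ι → κ → Measure α) [∀ i k, SigmaFinite (ν i k)] [∀ i, SigmaFinite (∑ k, ν i k)] :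
    Measure.pi (fun i => ∑ k, ν i k) = ∑ w : ι → κ, Measure.pi fun i => ν i (w i) := by
  refine Measure.pi_eq fun s _ => ?_
  simp only [Measure.finsetSum_apply, Measure.pi_pi, Finset.prod_univ_sum, Fintype.piFinset_univ]

variable {E : Type*} [NormedAddCommGroup E] [NormedSpace ℝ E]

theorem integrable_weightedLaw_iff (hρ : Measurable ρ) (hρ_nonneg : ∀ ω, 0 ≤ ρ ω)
    (hZ : Measurable Z) {f : α → E} (hf : AEStronglyMeasurable f (weightedLaw μ ρ Z)) :
    Integrable f (weightedLaw μ ρ Z) ↔ Integrable (fun ω => ρ ω • f (Z ω)) μ := by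
  rw [weightedLaw, integrable_map_measure hf hZ.aemeasurable,
    integrable_withDensity_iff_integrable_smul' hρ.ennreal_ofReal
      (.of_forall fun _ => ENNReal.ofReal_lt_top)]
  simp only [ENNReal.toReal_ofReal (hρ_nonneg _), Function.comp_apply]

theorem integral_weightedLaw (hρ : Measurable ρ) (hρ_nonneg : ∀ ω, 0 ≤ ρ ω) (hZ : Measurable Z)
    {f : α → E} (hf : AEStronglyMeasurable f (weightedLaw μ ρ Z)) :
    ∫ a, f a ∂weightedLaw μ ρ Z = ∫ ω, ρ ω • f (Z ω) ∂μ := by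
  rw [weightedLaw, integral_map hZ.aemeasurable hf,
    integral_withDensity_eq_integral_toReal_smul hρ.ennreal_ofReal
      (.of_forall fun _ => ENNReal.ofReal_lt_top)]
  simp only [ENNReal.toReal_ofReal (hρ_nonneg _)]

end WeightedLaws

section Rules

variable {𝓧 : Type*} {π : 𝓧 → ℝ}

/-- Probability that the rule `π` assigns the treatment `w` to covariates `x`. -/
def ruleWeight (π : 𝓧 → ℝ) (w : Bool) (x : 𝓧) : ℝ := if w then π x else 1 - π x

/-- A treatment rule: a measurable map from covariates to probabilities of treatment. -/
structure IsTreatmentRule [MeasurableSpace 𝓧] (π : 𝓧 → ℝ) : Prop where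
  measurable : Measurable π
  mem_Icc : ∀ x, π x ∈ Set.Icc (0 : ℝ) 1

theorem policyWeight_eq_prod {n : ℕ} (π : 𝓧 → ℝ) (x : Fin n → 𝓧) (w : Fin n → Bool) :
    policyWeight π x w = ∏ i, ruleWeight π (w i) (x i) := rfl

theorem sum_policyWeight {n : ℕ} (π : 𝓧 → ℝ) (x : Fin n → 𝓧) :
    ∑ w : Fin n → Bool, policyWeight π x w = 1 := by
  simp only [policyWeight_eq_prod]
  rw [← Fintype.prod_sum fun i b => ruleWeight π b (x i)]
  simp [ruleWeight]

theorem policyExp_sub_const {n : ℕ} (π : 𝓧 → ℝ) (x : Fin n → 𝓧) (f : (Fin n → Bool) → ℝ)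
    (v : ℝ) :
    policyExp π x f - v = policyExp π x fun w => f w - v := by
  simp only [policyExp, mul_sub, Finset.sum_sub_distrib, ← Finset.sum_mul, sum_policyWeight,
    one_mul]

theorem ruleWeight_constRule (w b : Bool) (x : 𝓧) :
    ruleWeight (constRule 𝓧 w) b x = if b = w then 1 else 0 := by
  cases b <;> cases w <;> simp [ruleWeight, constRule]

theorem policyExp_constRule {n : ℕ} (w : Bool) (x : Fin n → 𝓧) (f : (Fin n → Bool) → ℝ) :
    policyExp (constRule 𝓧 w) x f = f fun _ => w := by
  rw [policyExp, Fintype.sum_eq_single fun _ => w]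
  · simp [policyWeight_eq_prod, ruleWeight_constRule]
  · intro w' hne
    obtain ⟨i, hi⟩ := Function.ne_iff.1 hne
    rw [policyWeight_eq_prod, Finset.prod_eq_zero (Finset.mem_univ i)
      (by simp [ruleWeight_constRule, hi]), zero_mul]

namespace IsTreatmentRule

variable [MeasurableSpace 𝓧] (hπ : IsTreatmentRule π)

include hπ

theorem ruleWeight_nonneg (w : Bool) (x : 𝓧) : 0 ≤ ruleWeight π w x := by
  have := hπ.mem_Icc x
  cases w <;> simp [ruleWeight, this.1, this.2]

theorem ruleWeight_le_one (w : Bool) (x : 𝓧) : ruleWeight π w x ≤ 1 := by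
  have := hπ.mem_Icc x
  cases w <;> simp [ruleWeight, this.1, this.2]

theorem norm_ruleWeight_le_one (w : Bool) (x : 𝓧) : ‖ruleWeight π w x‖ ≤ 1 := by
  rw [Real.norm_of_nonneg (hπ.ruleWeight_nonneg w x)]
  exact hπ.ruleWeight_le_one w x

theorem measurable_ruleWeight (w : Bool) : Measurable (ruleWeight π w) := by
  cases w
  · exact hπ.measurable.const_sub 1
  · exact hπ.measurable

theorem policyWeight_nonneg {n : ℕ} (x : Fin n → 𝓧) (w : Fin n → Bool) : 0 ≤ policyWeight π x w :=
  Finset.prod_nonneg fun i _ => hπ.ruleWeight_nonneg (w i) (x i)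

theorem measurable_policyWeight {n : ℕ} (w : Fin n → Bool) :
    Measurable fun x : Fin n → 𝓧 => policyWeight π x w :=
  Finset.measurable_prod _ fun i _ => (hπ.measurable_ruleWeight (w i)).comp (measurable_pi_apply i)

theorem abs_policyExp_le {n : ℕ} (x : Fin n → 𝓧) (f : (Fin n → Bool) → ℝ) :
    |policyExp π x f| ≤ policyExp π x fun w => |f w| := by
  refine (Finset.abs_sum_le_sum_abs _ _).trans_eq (Finset.sum_congr rfl fun w _ => ?_)
  rw [abs_mul, abs_of_nonneg (hπ.policyWeight_nonneg x w)]

end IsTreatmentRule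

end Rules

namespace Market

variable {Ω 𝓧 𝓑 : Type*} {J : ℕ} {M : Market Ω 𝓧 𝓑 J} [MeasurableSpace Ω] [MeasurableSpace 𝓧]
  [MeasurableSpace 𝓑] {μ : Measure Ω} {π : 𝓧 → ℝ}

theorem Sampling.identDistrib_submission (hM : M.Sampling μ) (w : Bool) (i : ℕ) :
    IdentDistrib (fun ω => (M.X i ω, M.B w i ω)) (fun ω => (M.X 0 ω, M.B w 0 ω)) μ μ := by
  cases w
  · exact (hM.identDistrib i).comp (u := fun t => (t.1, t.2.2.1)) (by fun_prop)
  · exact (hM.identDistrib i).comp (u := fun t => (t.1, t.2.1)) (by fun_prop)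

theorem Sampling.iIndepFun_submission (hM : M.Sampling μ) {n : ℕ} (w : Fin n → Bool) :
    iIndepFun (fun (i : Fin n) ω => (M.X i ω, M.B (w i) i ω)) μ := by
  have h_meas : ∀ i, Measurable fun t : 𝓧 × 𝓑 × 𝓑 × Bool =>
      (t.1, if w i then t.2.1 else t.2.2.1) := fun i => by
    cases w i
    · exact measurable_fst.prodMk measurable_snd.snd.fst
    · exact measurable_fst.prodMk measurable_snd.fst
  refine ((hM.indep.precomp Fin.val_injective).comp _ h_meas).congr fun i => .of_forall fun ω => ?_
  cases w i <;> simp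

theorem Sampling.measurable_covariates (hM : M.Sampling μ) (n : ℕ) :
    Measurable (M.covariates n) := measurable_pi_lambda _ fun i => hM.measurable_X i

theorem Sampling.measurable_bids (hM : M.Sampling μ) (n : ℕ) (w : Fin n → Bool) :
    Measurable (M.bids n w) := measurable_pi_lambda _ fun i => hM.measurable_B (w i) i

/-- The law of the submission of a participant who is treated according to the rule `π`. -/
def policyLaw (M : Market Ω 𝓧 𝓑 J) (μ : Measure Ω) (π : 𝓧 → ℝ) : Measure 𝓑 :=
  ∑ w : Bool, weightedLaw μ (fun ω => ruleWeight π w (M.X 0 ω)) (M.B w 0)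

theorem Sampling.measurable_ruleWeight (hM : M.Sampling μ) (hπ : IsTreatmentRule π) (w : Bool)
    (i : ℕ) : Measurable fun ω => ruleWeight π w (M.X i ω) :=
  (hπ.measurable_ruleWeight w).comp (hM.measurable_X i)

section PopulationMeans

variable {E : Type*} [NormedAddCommGroup E] [NormedSpace ℝ E]

theorem Sampling.integrable_ruleWeight_smul (hM : M.Sampling μ) (hπ : IsTreatmentRule π)
    {f : 𝓑 → E} (hf : Integrable f (M.policyLaw μ π)) (w : Bool) :
    Integrable (fun ω => ruleWeight π w (M.X 0 ω) • f (M.B w 0 ω)) μ := by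
  have hf_w := integrable_finsetSum_measure.1 hf w (Finset.mem_univ w)
  exact (integrable_weightedLaw_iff (hM.measurable_ruleWeight hπ w 0)
    (fun ω => hπ.ruleWeight_nonneg _ _) (hM.measurable_B w 0) hf_w.aestronglyMeasurable).1 hf_w

theorem Sampling.integral_policyLaw (hM : M.Sampling μ) (hπ : IsTreatmentRule π)
    {f : 𝓑 → E} (hf : Integrable f (M.policyLaw μ π)) :
    ∫ b, f b ∂M.policyLaw μ π = ∑ w, ∫ ω, ruleWeight π w (M.X 0 ω) • f (M.B w 0 ω) ∂μ := by
  have hf_w := integrable_finsetSum_measure.1 hf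
  rw [policyLaw, integral_finsetSum_measure hf_w]
  exact Finset.sum_congr rfl fun w hw => integral_weightedLaw (hM.measurable_ruleWeight hπ w 0)
    (fun ω => hπ.ruleWeight_nonneg _ _) (hM.measurable_B w 0) (hf_w w hw).aestronglyMeasurable

theorem Sampling.popY_eq_integral_policyLaw (hM : M.Sampling μ) (hπ : IsTreatmentRule π) {p : RJ J}
    (hy : Integrable (M.y · p) (M.policyLaw μ π)) :
    M.popY μ π p = ∫ b, M.y b p ∂M.policyLaw μ π := by
  have h_int := hM.integrable_ruleWeight_smul hπ hy
  rw [hM.integral_policyLaw hπ hy, Fintype.sum_bool, ← integral_add (h_int true) (h_int false)]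
  rfl

theorem Sampling.popZ_eq_integral_policyLaw (hM : M.Sampling μ) (hπ : IsTreatmentRule π) {p : RJ J}
    (hd : Integrable (M.d · p) (M.policyLaw μ π)) :
    M.popZ μ π p = ∫ b, M.d b p ∂M.policyLaw μ π - M.cap := by
  have h_int := hM.integrable_ruleWeight_smul hπ hd
  rw [hM.integral_policyLaw hπ hd, Fintype.sum_bool, ← integral_add (h_int true) (h_int false)]
  rfl

end PopulationMeans

variable [IsProbabilityMeasure μ]

theorem Sampling.isFiniteMeasure_weightedLaw (hM : M.Sampling μ) (hπ : IsTreatmentRule π)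
    (w : Bool) (i : ℕ) :
    IsFiniteMeasure (weightedLaw μ (fun ω => ruleWeight π w (M.X i ω)) (M.B w i)) :=
  CutoffMarket.isFiniteMeasure_weightedLaw (.of_bound
    (hM.measurable_ruleWeight hπ w i).aestronglyMeasurable 1
    (.of_forall fun _ => hπ.norm_ruleWeight_le_one w _))

theorem Sampling.isProbabilityMeasure_policyLaw (hM : M.Sampling μ) (hπ : IsTreatmentRule π) :
    IsProbabilityMeasure (M.policyLaw μ π) := by
  have h_sum : ∀ ω, ∑ w, ENNReal.ofReal (ruleWeight π w (M.X 0 ω)) = 1 := fun ω => by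
    rw [← ENNReal.ofReal_sum_of_nonneg fun w _ => hπ.ruleWeight_nonneg w _]
    simp [ruleWeight]
  constructor
  simp only [policyLaw, Measure.finsetSum_apply, weightedLaw_univ (hM.measurable_B _ 0)]
  rw [← lintegral_finsetSum _ fun w _ => (hM.measurable_ruleWeight hπ w 0).ennreal_ofReal]
  simp only [h_sum, lintegral_const, measure_univ, one_mul]

theorem Sampling.sampleLaw_policyLaw (hM : M.Sampling μ) (hπ : IsTreatmentRule π) (n : ℕ) :
    sampleLaw (M.policyLaw μ π) n
      = ∑ w, weightedLaw μ (fun ω => policyWeight π (M.covariates n ω) w) (M.bids n w) := by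
  have := hM.isFiniteMeasure_weightedLaw hπ
  simp only [sampleLaw, policyLaw]
  rw [pi_sum_eq_sum_pi]
  refine Finset.sum_congr rfl fun w _ => ?_
  have law_eq : ∀ i : Fin n, weightedLaw μ (fun ω => ruleWeight π (w i) (M.X 0 ω)) (M.B (w i) 0)
      = weightedLaw μ (fun ω => ruleWeight π (w i) (M.X i ω)) (M.B (w i) i) := fun i =>
    weightedLaw_eq_of_identDistrib ((hM.identDistrib_submission (w i) i).symm.comp
      (((hπ.measurable_ruleWeight (w i)).comp measurable_fst).prodMk measurable_snd))
      (hM.measurable_B _ _) (hM.measurable_B _ _)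
  simp only [law_eq]
  exact (weightedLaw_prod_eq_pi (Z := fun (i : Fin n) ω => M.B (w i) i ω)
    ((hM.iIndepFun_submission w).comp (fun i t => (ruleWeight π (w i) t.1, t.2)) fun i =>
      ((hπ.measurable_ruleWeight (w i)).comp measurable_fst).prodMk measurable_snd)
    (fun i => hM.measurable_ruleWeight hπ (w i) i) (fun i ω => hπ.ruleWeight_nonneg _ _)
    fun i => hM.measurable_B (w i) i).symm

theorem Sampling.integrable_policyWeight_mul (hM : M.Sampling μ) (hπ : IsTreatmentRule π) {n : ℕ}
    {F : (Fin n → 𝓑) → ℝ} (hF : Integrable F (sampleLaw (M.policyLaw μ π) n))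
    (w : Fin n → Bool) :
    Integrable (fun ω => policyWeight π (M.covariates n ω) w * F (M.bids n w ω)) μ := by
  rw [hM.sampleLaw_policyLaw hπ, integrable_finsetSum_measure] at hF
  have hF_w := hF w (Finset.mem_univ w)
  exact (integrable_weightedLaw_iff ((hπ.measurable_policyWeight w).comp
    (hM.measurable_covariates n)) (fun ω => hπ.policyWeight_nonneg _ w) (hM.measurable_bids n w)
    hF_w.aestronglyMeasurable).1 hF_w

theorem Sampling.integrable_policyExp_bids (hM : M.Sampling μ) (hπ : IsTreatmentRule π) {n : ℕ}
    {F : (Fin n → 𝓑) → ℝ} (hF : Integrable F (sampleLaw (M.policyLaw μ π) n)) :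
    Integrable (fun ω => policyExp π (M.covariates n ω) fun w => F (M.bids n w ω)) μ :=
  integrable_finsetSum _ fun w _ => hM.integrable_policyWeight_mul hπ hF w

theorem Sampling.integral_policyExp_bids (hM : M.Sampling μ) (hπ : IsTreatmentRule π) {n : ℕ}
    {F : (Fin n → 𝓑) → ℝ} (hF : Integrable F (sampleLaw (M.policyLaw μ π) n)) :
    ∫ ω, policyExp π (M.covariates n ω) (fun w => F (M.bids n w ω)) ∂μ
      = ∫ b, F b ∂sampleLaw (M.policyLaw μ π) n := by
  simp only [policyExp]
  rw [integral_finsetSum _ fun w _ => hM.integrable_policyWeight_mul hπ hF w]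
  rw [hM.sampleLaw_policyLaw hπ] at hF ⊢
  rw [integral_finsetSum_measure fun w hw => integrable_finsetSum_measure.1 hF w hw]
  refine Finset.sum_congr rfl fun w hw => ?_
  exact (integral_weightedLaw ((hπ.measurable_policyWeight w).comp (hM.measurable_covariates n))
    (fun ω => hπ.policyWeight_nonneg _ w) (hM.measurable_bids n w)
    (integrable_finsetSum_measure.1 hF w hw).aestronglyMeasurable).symm

theorem Sampling.integral_abs_policyExp_bids_le (hM : M.Sampling μ) (hπ : IsTreatmentRule π)
    {n : ℕ} {F : (Fin n → 𝓑) → ℝ} (hF : Integrable F (sampleLaw (M.policyLaw μ π) n)) :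
    ∫ ω, |policyExp π (M.covariates n ω) fun w => F (M.bids n w ω)| ∂μ
      ≤ ∫ b, |F b| ∂sampleLaw (M.policyLaw μ π) n := by
  rw [← hM.integral_policyExp_bids hπ hF.abs]
  exact integral_mono (hM.integrable_policyExp_bids hπ hF).abs
    (hM.integrable_policyExp_bids hπ hF.abs) fun ω => hπ.abs_policyExp_le _ _

theorem Sampling.isBigO_integral_abs_policyExp_bids (hM : M.Sampling μ) (hπ : IsTreatmentRule π)
    {T : ∀ n, (Fin n → 𝓑) → ℝ}
    (hT : ∀ᶠ n in atTop, Integrable (T n) (sampleLaw (M.policyLaw μ π) n)) :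
    (fun n => ∫ ω, ‖policyExp π (M.covariates n ω) fun w => T n (M.bids n w ω)‖ ∂μ)
      =O[atTop] fun n => ∫ b, ‖T n b‖ ∂sampleLaw (M.policyLaw μ π) n := by
  refine .of_norm_eventuallyLE (hT.mono fun n hn => ?_)
  refine (Real.norm_of_nonneg (integral_nonneg fun _ => norm_nonneg _)).trans_le ?_
  exact hM.integral_abs_policyExp_bids_le hπ hn

theorem Sampling.littleOInMean_policyExp (hM : M.Sampling μ) (hπ : IsTreatmentRule π)
    {T : ∀ n, (Fin n → 𝓑) → ℝ} {r : ℕ → ℝ} (hT : LittleOInMean (sampleLaw (M.policyLaw μ π)) T r) :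
    LittleOInMean (fun _ => μ)
      (fun n ω => policyExp π (M.covariates n ω) fun w => T n (M.bids n w ω)) r where
  integrable := hT.integrable.mono fun _ => hM.integrable_policyExp_bids hπ
  isLittleO := (hM.isBigO_integral_abs_policyExp_bids hπ hT.integrable).trans_isLittleO hT.isLittleO

theorem Sampling.bigOInMean_policyExp (hM : M.Sampling μ) (hπ : IsTreatmentRule π)
    {T : ∀ n, (Fin n → 𝓑) → ℝ} {r : ℕ → ℝ} (hT : BigOInMean (sampleLaw (M.policyLaw μ π)) T r) :
    BigOInMean (fun _ => μ)
      (fun n ω => policyExp π (M.covariates n ω) fun w => T n (M.bids n w ω)) r where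
  integrable := hT.integrable.mono fun _ => hM.integrable_policyExp_bids hπ
  isBigO := (hM.isBigO_integral_abs_policyExp_bids hπ hT.integrable).trans hT.isBigO

end Market

/-! ### Clearing cutoffs under a treatment rule -/

theorem LittleOInMean.of_measureReal_lt_le {α : ℕ → Type*} [∀ n, MeasurableSpace (α n)]
    {μ : ∀ n, Measure (α n)} [∀ n, IsProbabilityMeasure (μ n)] {E : Type*} [NormedAddCommGroup E]
    {T : ∀ n, α n → E} {a δ r : ℕ → ℝ} {K : ℝ} (hT : ∀ n, StronglyMeasurable (T n))
    (hK : ∀ᶠ n in atTop, ∀ b, ‖T n b‖ ≤ K)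
    (h : ∀ᶠ n in atTop, (μ n).real {b | a n < ‖T n b‖} ≤ δ n)
    (ha : a =o[atTop] r) (hδ : δ =o[atTop] r) : LittleOInMean μ T r where
  integrable := hK.mono fun n hn => .of_bound (hT n).aestronglyMeasurable K (.of_forall hn)
  isLittleO := by
    refine Asymptotics.IsBigO.trans_isLittleO (.of_norm_eventuallyLE ?_)
      (ha.abs_left.add (hδ.const_mul_left |K|))
    filter_upwards [hK, h] with n hKn hn
    have h_meas : MeasurableSet {b | a n < ‖T n b‖} :=
      measurableSet_lt measurable_const (hT n).norm.measurable
    have h_indicator := (integrable_const (μ := μ n) |K|).indicator h_meas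
    have h_le : ∀ b, ‖T n b‖ ≤ |a n| + {b | a n < ‖T n b‖}.indicator (fun _ => |K|) b := by
      intro b
      by_cases hb : b ∈ {b | a n < ‖T n b‖}
      · rw [Set.indicator_of_mem hb]
        linarith [hKn b, le_abs_self K, abs_nonneg (a n)]
      · rw [Set.indicator_of_notMem hb, add_zero]
        exact (not_lt.1 hb).trans (le_abs_self _)
    calc ‖∫ b, ‖T n b‖ ∂μ n‖ = ∫ b, ‖T n b‖ ∂μ n :=
          Real.norm_of_nonneg (integral_nonneg fun _ => norm_nonneg _)
      _ ≤ ∫ b, (|a n| + {b | a n < ‖T n b‖}.indicator (fun _ => |K|) b) ∂μ n :=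
          integral_mono_of_nonneg (.of_forall fun _ => norm_nonneg _)
            ((integrable_const _).add h_indicator) (.of_forall h_le)
      _ = |a n| + |K| * (μ n).real {b | a n < ‖T n b‖} := by
          rw [integral_add (integrable_const _) h_indicator, integral_indicator_const _ h_meas,
            integral_const, probReal_univ, one_smul, smul_eq_mul, mul_comm |K|]
      _ ≤ |a n| + |K| * δ n := by gcongr

theorem isLittleO_exp_neg_mul_natCast_rpow {c : ℝ} (hc : 0 < c) (s : ℝ) :
    (fun n : ℕ => Real.exp (-c * n)) =o[atTop] fun n => (n : ℝ) ^ s := by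
  have := (isLittleO_exp_neg_mul_rpow_atTop hc s).comp_tendsto tendsto_natCast_atTop_atTop
  simpa only [Function.comp_def] using this

theorem continuousOn_integral_of_integral_sq_sub_le {α E : Type*} [MeasurableSpace α]
    {ν : Measure α} [IsProbabilityMeasure ν] [SeminormedAddCommGroup E] {S : Set E} {L : ℝ}
    {g : α → E → ℝ} (hg : ∀ p ∈ S, MemLp (g · p) 2 ν)
    (hL : ∀ p ∈ S, ∀ p' ∈ S, ∫ x, (g x p - g x p') ^ 2 ∂ν ≤ L * ‖p - p'‖) :
    ContinuousOn (fun p => ∫ x, g x p ∂ν) S := by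
  intro p' hp'
  rw [ContinuousWithinAt, tendsto_iff_norm_sub_tendsto_zero]
  have h_lim : Tendsto (fun p => √(L * ‖p - p'‖)) (𝓝[S] p') (𝓝 0) := by
    have : Continuous fun p => √(L * ‖p - p'‖) := by fun_prop
    simpa using (this.tendsto p').mono_left nhdsWithin_le_nhds
  refine squeeze_zero' (.of_forall fun p => norm_nonneg _) ?_ h_lim
  filter_upwards [self_mem_nhdsWithin] with p hp
  rw [← integral_sub ((hg p hp).integrable one_le_two) ((hg p' hp').integrable one_le_two)]
  exact Real.abs_le_sqrt ((sq_integral_le_integral_sq ((hg p hp).sub (hg p' hp'))).trans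
    (hL p hp p' hp'))

namespace Market

variable {Ω 𝓧 𝓑 : Type*} {J : ℕ} {M : Market Ω 𝓧 𝓑 J} {n : ℕ}

/-- Excess demand per participant at the cutoffs that the mechanism computes. -/
def excessDemand (M : Market Ω 𝓧 𝓑 J) (b : Fin n → 𝓑) : RJ J :=
  𝔼 i, M.d (b i) (M.cutoff n b) - M.cap

theorem P_mem_clearing_iff {a : ℝ} {w : Fin n → Bool} {ω : Ω} :
    M.P n w ω ∈ M.clearing n a w ω ↔ ‖M.excessDemand (M.bids n w ω)‖ ≤ a := by
  rw [excessDemand, expect_eq_smul_sum, Finset.smul_sum]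
  rfl

theorem norm_excessDemand_le [NeZero n] {K : ℝ} (hK : ∀ b, ∀ p ∈ M.S, ‖M.d b p‖ ≤ K)
    {b : Fin n → 𝓑} (hb : M.cutoff n b ∈ M.S) : ‖M.excessDemand b‖ ≤ K + ‖M.cap‖ := by
  refine (norm_sub_le _ _).trans (add_le_add_left ?_ _)
  rw [expect_eq_smul_sum, norm_smul, Real.norm_of_nonneg (by positivity), one_div_mul_eq_div,
    div_le_iff₀' (Nat.cast_pos.2 (NeZero.pos n))]
  simpa using norm_sum_le_of_le Finset.univ fun i _ => hK (b i) _ hb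

variable [MeasurableSpace Ω] [MeasurableSpace 𝓧] [MeasurableSpace 𝓑] {μ : Measure Ω} {π : 𝓧 → ℝ}

theorem Sampling.measurable_excessDemand (hM : M.Sampling μ) :
    Measurable (M.excessDemand (n := n)) := by
  unfold excessDemand
  simp only [expect_eq_smul_sum]
  have h_sum : Measurable fun b : Fin n → 𝓑 => ∑ i, M.d (b i) (M.cutoff n b) :=
    Finset.measurable_sum _ fun i _ =>
      hM.measurable_d.comp ((measurable_pi_apply i).prodMk (hM.measurable_cutoff n))
  exact Measurable.sub_const (h_sum.const_smul (1 / (n : ℝ))) M.cap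

theorem Sampling.memLp_demand (hM : M.Sampling μ) {ν : Measure 𝓑} [IsFiniteMeasure ν] {p : RJ J}
    {K : ℝ} (hK : ∀ b, ‖M.d b p‖ ≤ K) : MemLp (M.d · p) 2 ν :=
  .of_bound (hM.measurable_d.comp measurable_prodMk_right).aestronglyMeasurable K (.of_forall hK)

theorem Sampling.boundedFamily_demand (hM : M.Sampling μ) {K : ℝ}
    (hK : ∀ b, ∀ p ∈ M.S, ‖M.d b p‖ ≤ K) (j : Fin J) :
    BoundedFamily (fun b p => M.d b p j) M.S K where
  measurable := (EuclideanSpace.proj (𝕜 := ℝ) j).measurable.comp hM.measurable_d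
  bounded b p hp := (PiLp.norm_apply_le _ j).trans (hK b p hp)

variable [IsProbabilityMeasure μ]

theorem Sampling.integral_policyExp_clearing_le (hM : M.Sampling μ) (hπ : IsTreatmentRule π)
    {a : ℝ} (hP : ∀ w : Fin n → Bool, ∀ᵐ ω ∂μ,
      (M.clearing n a w ω).Nonempty → M.P n w ω ∈ M.clearing n a w ω) :
    ∫ ω, policyExp π (M.covariates n ω)
        (Set.indicator {w | (M.clearing n a w ω).Nonempty} fun _ => 1) ∂μ
      ≤ (sampleLaw (M.policyLaw μ π) n).real {b | ‖M.excessDemand b‖ ≤ a} := by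
  have := hM.isProbabilityMeasure_policyLaw hπ
  have h_meas : MeasurableSet {b : Fin n → 𝓑 | ‖M.excessDemand b‖ ≤ a} :=
    measurableSet_le hM.measurable_excessDemand.norm measurable_const
  rw [← integral_indicator_one h_meas, ← hM.integral_policyExp_bids hπ
    (F := Set.indicator _ 1) ((integrable_const 1).indicator h_meas)]
  refine (integral_congr_ae ?_).le
  filter_upwards [ae_all_iff.2 hP] with ω hω
  refine congrArg _ (funext fun w => ?_)
  have nonempty_iff : (M.clearing n a w ω).Nonempty ↔ ‖M.excessDemand (M.bids n w ω)‖ ≤ a :=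
    ⟨fun h => P_mem_clearing_iff.1 (hω w h), fun h => ⟨_, P_mem_clearing_iff.2 h⟩⟩
  simp only [Set.indicator, Set.mem_ofPred_eq, nonempty_iff, Pi.one_apply]

theorem Sampling.littleOInMean_excessDemand (hM : M.Sampling μ) {Pol : Set (𝓧 → ℝ)}
    (hC : M.CutoffMechanism μ Pol) (hmem : π ∈ Pol) (hπ : IsTreatmentRule π) :
    LittleOInMean (sampleLaw (M.policyLaw μ π)) (fun n b => M.excessDemand (n := n) b)
      fun n => (n : ℝ) ^ (-(1 / 2) : ℝ) := by
  have := hM.isProbabilityMeasure_policyLaw hπ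
  obtain ⟨K, hK⟩ := hC.bounded_d
  obtain ⟨a, c, hc, ha, h_clear, hP⟩ := hC.clears
  refine .of_measureReal_lt_le (a := a) (K := K + ‖M.cap‖)
    (fun n => hM.measurable_excessDemand.stronglyMeasurable) ?_ ?_ ?_
    (isLittleO_exp_neg_mul_natCast_rpow hc _)
  · filter_upwards [eventually_gt_atTop 0] with n hn b
    have : NeZero n := ⟨hn.ne'⟩
    exact norm_excessDemand_le hK (hC.cutoff_mem n hn b)
  · filter_upwards [eventually_gt_atTop 0] with n hn
    have h_meas : MeasurableSet {b : Fin n → 𝓑 | ‖M.excessDemand b‖ ≤ a n} :=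
      measurableSet_le hM.measurable_excessDemand.norm measurable_const
    have h_compl := probReal_compl_eq_one_sub (μ := sampleLaw (M.policyLaw μ π) n) h_meas
    simp only [Set.compl_ofPred, not_le] at h_compl
    rw [h_compl, sub_le_comm]
    exact (h_clear π hmem n hn).trans (hM.integral_policyExp_clearing_le hπ (hP n hn))
  · refine Asymptotics.isLittleO_of_tendsto' ?_ (ha.congr fun n => ?_)
    · filter_upwards [eventually_gt_atTop 0] with n hn h_zero
      exact absurd h_zero (by positivity)
    · rw [Real.rpow_neg n.cast_nonneg, div_inv_eq_mul, Real.sqrt_eq_rpow]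

end Market

theorem BoundedFamily.memLp_apply {𝓑 Θ : Type*} [MeasurableSpace 𝓑] [MeasurableSpace Θ]
    {g : 𝓑 → Θ → ℝ} {S : Set Θ} {K : ℝ} (hg : BoundedFamily g S K) {ν : Measure 𝓑}
    [IsFiniteMeasure ν] {p : Θ} (hp : p ∈ S) {q : ENNReal} : MemLp (g · p) q ν :=
  .of_bound (hg.measurable.comp measurable_prodMk_right).aestronglyMeasurable K
    (.of_forall fun b => hg.bounded b p hp)

namespace Market

variable {Ω 𝓧 𝓑 : Type*} {J : ℕ} {M : Market Ω 𝓧 𝓑 J}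

/-- The outcome net of the value, at shadow prices `φ`, of the excess demand of a submission; the
paper's `q_w(·, p)` is the case `φ = ν*_w`. -/
def correctedOutcome (M : Market Ω 𝓧 𝓑 J) (φ : RJ J →L[ℝ] ℝ) (p : RJ J) (b : 𝓑) : ℝ :=
  M.y b p - φ (M.d b p - M.cap)

/-- The average outcome in a finite market, as a function of the submissions. -/
def avgOutcome (M : Market Ω 𝓧 𝓑 J) {n : ℕ} (b : Fin n → 𝓑) : ℝ :=
  𝔼 i, M.y (b i) (M.cutoff n b)

theorem one_div_mul_sum_outcome (n : ℕ) (w : Fin n → Bool) (ω : Ω) :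
    (1 / (n : ℝ)) * ∑ i : Fin n, M.outcome n w i ω = M.avgOutcome (M.bids n w ω) :=
  (expect_eq_smul_sum _).symm

theorem finiteValue_eq_policyExp (n : ℕ) (π : 𝓧 → ℝ) (ω : Ω) :
    M.finiteValue n π ω
      = policyExp π (M.covariates n ω) fun w => M.avgOutcome (M.bids n w ω) := by
  simp only [finiteValue, one_div_mul_sum_outcome]

variable [MeasurableSpace Ω] [MeasurableSpace 𝓧]
  {μ : Measure Ω} {Pol : Set (𝓧 → ℝ)} {π : 𝓧 → ℝ} {pstar : (𝓧 → ℝ) → RJ J} {c' c₃ c₄ K : ℝ}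

/-- The linear form that converts excess demand at the cutoffs `p` into outcomes under the rule
`π`; it is the paper's `ν*_w` when `π` treats everybody or nobody. -/
def shadowPrice (M : Market Ω 𝓧 𝓑 J) (μ : Measure Ω) (π : 𝓧 → ℝ) (p : RJ J) : RJ J →L[ℝ] ℝ :=
  (fderiv ℝ (M.popY μ π) p).comp (fderiv ℝ (M.popZ μ π) p).inverse

theorem RegularOutcomes.injective_fderiv_popZ (hO : M.RegularOutcomes μ Pol pstar c' c₃ c₄)
    (hc₃ : 0 < c₃) (hmem : π ∈ Pol) :
    Function.Injective (fderiv ℝ (M.popZ μ π) (pstar π)) :=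
  (LinearMap.injective_iff_forall_lt_finrank_singularValues_pos
    (T := (fderiv ℝ (M.popZ μ π) (pstar π)).toLinearMap)).2 fun k hk =>
      hc₃.trans_le (hO.jacobian π hmem k (by simpa using hk)).1

variable [MeasurableSpace 𝓑]

theorem Sampling.exists_bound (hM : M.Sampling μ) (hC : M.CutoffMechanism μ Pol)
    (hO : M.RegularOutcomes μ Pol pstar c' c₃ c₄) :
    ∃ K, (∀ b, ∀ p ∈ M.S, ‖M.d b p‖ ≤ K) ∧ BoundedFamily M.y M.S K := by
  obtain ⟨Kd, hd⟩ := hC.bounded_d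
  obtain ⟨Ky, hy⟩ := hO.bounded_y
  exact ⟨max Kd Ky, fun b p hp => (hd b p hp).trans (le_max_left _ _), hM.measurable_y,
    fun b p hp => (hy b p hp).trans (le_max_right _ _)⟩

variable [IsProbabilityMeasure μ]

theorem Sampling.differentiableAt_integral_policyLaw (hM : M.Sampling μ) (hπ : IsTreatmentRule π)
    {f : 𝓑 → RJ J → ℝ} {S : Set (RJ J)} (hf : BoundedFamily f S K) {m : Bool → 𝓧 → RJ J → ℝ}
    (hm : ∀ w, ∀ p ∈ S, Measurable fun x => m w x p)
    (h_cond : ∀ w, ∀ p ∈ S, (fun ω => m w (M.X 0 ω) p) =ᵐ[μ]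
      μ[fun ω => f (M.B w 0 ω) p | MeasurableSpace.comap (M.X 0) inferInstance])
    {c : ℝ} (hs : ∀ w x, SmoothBounded (m w x) (interior S) c) {p₀ : RJ J} (hp₀ : S ∈ 𝓝 p₀) :
    DifferentiableAt ℝ (fun p => ∫ b, f b p ∂M.policyLaw μ π) p₀ := by
  have := hM.isProbabilityMeasure_policyLaw hπ
  have hp₀_int := mem_interior_iff_mem_nhds.2 hp₀
  have h_conditional (w : Bool) : DifferentiableAt ℝ
      (fun p => ∫ ω, ruleWeight π w (M.X 0 ω) * m w (M.X 0 ω) p ∂μ) p₀ :=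
    differentiableAt_integral_mul (hM.measurable_X 0) (hπ.measurable_ruleWeight w)
      (hπ.norm_ruleWeight_le_one w) isOpen_interior hp₀_int
      (fun q hq => hm w q (interior_subset hq))
      (integrable_condExp.congr (h_cond w p₀ (mem_of_mem_nhds hp₀)).symm) (hs w)
  refine (DifferentiableAt.fun_sum (u := Finset.univ) fun w _ =>
    h_conditional w).congr_of_eventuallyEq ?_
  filter_upwards [hp₀] with p hp
  have hf_int := hf.integrable_apply (ν := M.policyLaw μ π) hp
  rw [hM.integral_policyLaw hπ hf_int]
  exact Finset.sum_congr rfl fun w _ => integral_mul_eq_of_condExp (m := (m w · p))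
    (hM.measurable_X 0) (hπ.measurable_ruleWeight w)
    ((hf.integrable_apply hp).comp_measurable (hM.measurable_B w 0))
    (hM.integrable_ruleWeight_smul hπ hf_int w) (h_cond w p hp)

theorem Sampling.integral_policyLaw_sq_sub_le (hM : M.Sampling μ) (hπ : IsTreatmentRule π)
    {Θ : Type*} [MeasurableSpace Θ] {g : 𝓑 → Θ → ℝ} {S : Set Θ} (hg : BoundedFamily g S K)
    {p p' : Θ} (hp : p ∈ S) (hp' : p' ∈ S) {R : ℝ}
    (hR : ∀ w, ∫ ω, (g (M.B w 0 ω) p - g (M.B w 0 ω) p') ^ 2 ∂μ ≤ R) :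
    ∫ b, (g b p - g b p') ^ 2 ∂M.policyLaw μ π ≤ 2 * R := by
  have := hM.isProbabilityMeasure_policyLaw hπ
  have h_int (ν : Measure 𝓑) [IsFiniteMeasure ν] : Integrable (fun b => (g b p - g b p') ^ 2) ν :=
    ((hg.memLp_apply hp).sub (hg.memLp_apply hp')).integrable_sq
  rw [hM.integral_policyLaw hπ (h_int _)]
  refine (Finset.sum_le_card_nsmul Finset.univ _ R fun w _ => ?_).trans_eq (by simp)
  refine (integral_mono_of_nonneg (.of_forall fun ω => ?_)
    ((h_int (μ.map (M.B w 0))).comp_measurable (hM.measurable_B w 0))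
    (.of_forall fun ω => ?_)).trans (hR w)
  · exact mul_nonneg (hπ.ruleWeight_nonneg w _) (sq_nonneg _)
  · exact mul_le_of_le_one_left (sq_nonneg _) (hπ.ruleWeight_le_one w _)

theorem Sampling.exists_holder_policyLaw (hM : M.Sampling μ)
    (hO : M.RegularOutcomes μ Pol pstar c' c₃ c₄) (hπ : IsTreatmentRule π)
    (hd : ∀ j, BoundedFamily (fun b p => M.d b p j) M.S K) (hy : BoundedFamily M.y M.S K) :
    ∃ L, ∀ p ∈ M.S, ∀ p' ∈ M.S,
      (∀ j, ∫ b, (M.d b p j - M.d b p' j) ^ 2 ∂M.policyLaw μ π ≤ L * ‖p - p'‖) ∧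
      ∫ b, (M.y b p - M.y b p') ^ 2 ∂M.policyLaw μ π ≤ L * ‖p - p'‖ := by
  obtain ⟨L, -, hL⟩ := hO.weakly_continuous
  refine ⟨2 * L, fun p hp p' hp' => ?_⟩
  rw [mul_assoc]
  exact ⟨fun j => hM.integral_policyLaw_sq_sub_le hπ (hd j) hp hp' fun w => (hL w p hp p' hp').1 j,
    hM.integral_policyLaw_sq_sub_le hπ hy hp hp' fun w => (hL w p hp p' hp').2⟩

theorem Sampling.continuousOn_integral_demand (hM : M.Sampling μ) (hπ : IsTreatmentRule π)
    (hK : ∀ b, ∀ p ∈ M.S, ‖M.d b p‖ ≤ K) {L : ℝ}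
    (hL : ∀ p ∈ M.S, ∀ p' ∈ M.S, ∀ j,
      ∫ b, (M.d b p j - M.d b p' j) ^ 2 ∂M.policyLaw μ π ≤ L * ‖p - p'‖) :
    ContinuousOn (fun p => ∫ b, M.d b p ∂M.policyLaw μ π) M.S := by
  have := hM.isProbabilityMeasure_policyLaw hπ
  have h_coord (j : Fin J) : ContinuousOn (fun p => ∫ b, M.d b p j ∂M.policyLaw μ π) M.S :=
    continuousOn_integral_of_integral_sq_sub_le
      (fun p hp => (hM.boundedFamily_demand hK j).memLp_apply hp)
      fun p hp p' hp' => hL p hp p' hp' j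
  refine ((PiLp.continuous_toLp 2 _).comp_continuousOn (continuousOn_pi.2 h_coord)).congr
    fun p hp => ?_
  ext j
  exact eval_integral_piLp (integrable_piLp_iff.1
    ((hM.memLp_demand fun b => hK b p hp).integrable one_le_two)) j

theorem Sampling.differentiableAt_popY (hM : M.Sampling μ)
    (hO : M.RegularOutcomes μ Pol pstar c' c₃ c₄) (hπ : IsTreatmentRule π) {p : RJ J}
    (hp : M.S ∈ 𝓝 p) : DifferentiableAt ℝ (M.popY μ π) p := by
  have := hM.isProbabilityMeasure_policyLaw hπ
  obtain ⟨K, hK⟩ := hO.bounded_y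
  obtain ⟨md, my, h_meas, h_version, h_smooth⟩ := hO.smooth
  have hy : BoundedFamily M.y M.S K := ⟨hM.measurable_y, hK⟩
  refine (hM.differentiableAt_integral_policyLaw hπ hy (fun w q hq => (h_meas w q hq).2)
    (fun w q hq => (h_version w 0 q hq).2) (fun w x => (h_smooth w x).2) hp)
      |>.congr_of_eventuallyEq ?_
  filter_upwards [hp] with q hq
  exact hM.popY_eq_integral_policyLaw hπ (hy.integrable_apply hq)

theorem Sampling.differentiableAt_popZ (hM : M.Sampling μ) (hC : M.CutoffMechanism μ Pol)
    (hO : M.RegularOutcomes μ Pol pstar c' c₃ c₄) (hπ : IsTreatmentRule π) {p : RJ J}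
    (hp : M.S ∈ 𝓝 p) : DifferentiableAt ℝ (M.popZ μ π) p := by
  have := hM.isProbabilityMeasure_policyLaw hπ
  obtain ⟨K, hK⟩ := hC.bounded_d
  obtain ⟨md, my, h_meas, h_version, h_smooth⟩ := hO.smooth
  have hd_int (ν : Measure 𝓑) [IsFiniteMeasure ν] {q : RJ J} (hq : q ∈ M.S) :
      Integrable (M.d · q) ν := (hM.memLp_demand fun b => hK b q hq).integrable one_le_two
  have h_version_coord (j : Fin J) (w : Bool) (q : RJ J) (hq : q ∈ M.S) :
      (fun ω => md w (M.X 0 ω) q j) =ᵐ[μ]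
        μ[fun ω => M.d (M.B w 0 ω) q j | MeasurableSpace.comap (M.X 0) inferInstance] := by
    filter_upwards [(EuclideanSpace.proj (𝕜 := ℝ) j).comp_condExp_comm
      ((hd_int (μ.map (M.B w 0)) hq).comp_measurable (hM.measurable_B w 0)),
      (h_version w 0 q hq).1] with ω h_coord h_eq
    rw [h_eq]
    exact h_coord
  have h_coord (j : Fin J) :
      DifferentiableAt ℝ (fun q => ∫ b, M.d b q j ∂M.policyLaw μ π) p :=
    hM.differentiableAt_integral_policyLaw (m := fun w x q => md w x q j) hπ
      (hM.boundedFamily_demand hK j) (fun w q hq =>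
        (EuclideanSpace.proj (𝕜 := ℝ) j).measurable.comp (h_meas w q hq).1)
      (h_version_coord j) (fun w x => (h_smooth w x).1 j) hp
  refine differentiableAt_euclidean.2 fun j =>
    ((h_coord j).sub_const (M.cap j)).congr_of_eventuallyEq ?_
  filter_upwards [hp] with q hq
  rw [hM.popZ_eq_integral_policyLaw hπ (hd_int _ hq), PiLp.sub_apply,
    eval_integral_piLp (integrable_piLp_iff.1 (hd_int _ hq))]

theorem Sampling.integral_correctedOutcome (hM : M.Sampling μ) (hπ : IsTreatmentRule π)
    {φ : RJ J →L[ℝ] ℝ} {p : RJ J} (hy : Integrable (M.y · p) (M.policyLaw μ π))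
    (hd : Integrable (M.d · p) (M.policyLaw μ π)) :
    ∫ b, M.correctedOutcome φ p b ∂M.policyLaw μ π = M.popY μ π p - φ (M.popZ μ π p) := by
  have := hM.isProbabilityMeasure_policyLaw hπ
  have hd_cap : Integrable (fun b => M.d b p - M.cap) (M.policyLaw μ π) :=
    hd.sub (integrable_const _)
  calc ∫ b, M.correctedOutcome φ p b ∂M.policyLaw μ π
      = ∫ b, M.y b p ∂M.policyLaw μ π - ∫ b, φ (M.d b p - M.cap) ∂M.policyLaw μ π :=
        integral_sub hy (φ.integrable_comp hd_cap)
    _ = M.popY μ π p - φ (M.popZ μ π p) := by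
        rw [φ.integral_comp_comm hd_cap, integral_sub hd (integrable_const _), integral_const,
          probReal_univ, one_smul, hM.popY_eq_integral_policyLaw hπ hy,
          hM.popZ_eq_integral_policyLaw hπ hd]

section Regular

variable (hM : M.Sampling μ) (hC : M.CutoffMechanism μ Pol)
  (hO : M.RegularOutcomes μ Pol pstar c' c₃ c₄) (hc₃ : 0 < c₃) (h_compact : IsCompact M.S)
  (hmem : π ∈ Pol) (hπ : IsTreatmentRule π) (h_eq : M.IsEquilibrium μ π (pstar π))
  (h_nhds : M.S ∈ 𝓝 (pstar π))

include hM hC hO hc₃ h_compact hmem hπ h_eq h_nhds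

theorem Sampling.exists_norm_sub_le_mul_norm_popZ :
    ∃ κ : ℝ, ∀ p ∈ M.S, ‖p - pstar π‖ ≤ κ * ‖M.popZ μ π p‖ := by
  have := hM.isProbabilityMeasure_policyLaw hπ
  obtain ⟨K, hK, hy⟩ := hM.exists_bound hC hO
  obtain ⟨L, hL⟩ := hM.exists_holder_policyLaw hO hπ (hM.boundedFamily_demand hK) hy
  have h_cont : ContinuousOn (M.popZ μ π) M.S :=
    ((hM.continuousOn_integral_demand hπ hK fun p hp p' hp' => (hL p hp p' hp').1).sub
      continuousOn_const).congr fun p hp => hM.popZ_eq_integral_policyLaw hπ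
        ((hM.memLp_demand fun b => hK b p hp).integrable one_le_two)
  exact Asymptotics.isBigO_principal.1 (isBigO_sub_principal_of_unique_zero h_compact h_cont
    h_eq.2.1 h_eq.2.2 (hM.differentiableAt_popZ hC hO hπ h_nhds).hasFDerivAt
    (hO.injective_fderiv_popZ hc₃ hmem))

theorem Sampling.exists_clearingSequence :
    ∃ K, ClearingSequence (M.policyLaw μ π) M.d M.y M.cap M.S M.cutoff (pstar π) K := by
  have := hM.isProbabilityMeasure_policyLaw hπ
  obtain ⟨K, hK, hy⟩ := hM.exists_bound hC hO
  obtain ⟨L, hL⟩ := hM.exists_holder_policyLaw hO hπ (hM.boundedFamily_demand hK) hy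
  obtain ⟨κ, hκ⟩ :=
    hM.exists_norm_sub_le_mul_norm_popZ hC hO hc₃ h_compact hmem hπ h_eq h_nhds
  obtain ⟨h_d, h_y, C, -, -, hC_pos, h_cover_d, h_cover_y⟩ := hO.entropy
  exact ⟨K, {
    measurable_demand := hM.measurable_d
    norm_demand_le := hK
    covers_demand := fun j => (h_cover_d j).polynomialCovers hC_pos
    outcome := ⟨hy, h_cover_y.polynomialCovers hC_pos⟩
    measurable_cutoff := hM.measurable_cutoff
    cutoff_mem := fun n _ b => hC.cutoff_mem n (NeZero.pos n) b
    base_mem := h_eq.1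
    holder := ⟨L, fun p hp => hL p hp _ h_eq.1⟩
    clears := hM.littleOInMean_excessDemand hC hmem hπ
    stable := ⟨κ, fun p hp => (hκ p hp).trans_eq <| by
      rw [hM.popZ_eq_integral_policyLaw hπ
        ((hM.memLp_demand fun b => hK b p hp).integrable one_le_two)]⟩ }⟩

theorem Sampling.littleOInMean_avgOutcome_sub :
    LittleOInMean (sampleLaw (M.policyLaw μ π)) (fun n b => M.avgOutcome b -
      𝔼 i : Fin n, M.correctedOutcome (M.shadowPrice μ π (pstar π)) (pstar π) (b i))
      fun n => (n : ℝ) ^ (-(1 / 2) : ℝ) := by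
  have := hM.isProbabilityMeasure_policyLaw hπ
  obtain ⟨K, H⟩ := hM.exists_clearingSequence hC hO hc₃ h_compact hmem hπ h_eq h_nhds
  refine H.littleOInMean_expect_outcome_sub ((isLittleO_sub_comp_inverse_fderiv
    (hM.differentiableAt_popZ hC hO hπ h_nhds) (hM.differentiableAt_popY hO hπ h_nhds)
    (hO.injective_fderiv_popZ hc₃ hmem)).congr' ?_ .rfl)
  filter_upwards [h_nhds] with p hp
  simp only [hM.popZ_eq_integral_policyLaw hπ (H.integrable_demand hp),
    hM.popZ_eq_integral_policyLaw hπ (H.integrable_demand h_eq.1),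
    hM.popY_eq_integral_policyLaw hπ (H.outcome.integrable_apply hp),
    hM.popY_eq_integral_policyLaw hπ (H.outcome.integrable_apply h_eq.1), sub_sub_sub_cancel_right]
  rfl

theorem Sampling.bigOInMean_avgOutcome_sub_popY :
    BigOInMean (sampleLaw (M.policyLaw μ π))
      (fun n b => M.avgOutcome (n := n) b - M.popY μ π (pstar π))
      fun n => (n : ℝ) ^ (-(1 / 2) : ℝ) := by
  have := hM.isProbabilityMeasure_policyLaw hπ
  obtain ⟨K, H⟩ := hM.exists_clearingSequence hC hO hc₃ h_compact hmem hπ h_eq h_nhds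
  set q := M.correctedOutcome (M.shadowPrice μ π (pstar π)) (pstar π) with hq
  have hy := H.outcome.memLp_apply (ν := M.policyLaw μ π) (q := 2) h_eq.1
  have hd := H.memLp_demand h_eq.1
  have integral_q : ∫ b, q b ∂M.policyLaw μ π = M.popY μ π (pstar π) := by
    rw [hM.integral_correctedOutcome hπ (hy.integrable one_le_two) (hd.integrable one_le_two),
      h_eq.2.1, map_zero, sub_zero]
  have memLp_q : MemLp q 2 (M.policyLaw μ π) :=
    hy.sub ((M.shadowPrice μ π (pstar π)).comp_memLp' (hd.sub (memLp_const _)))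
  have h_lin := hM.littleOInMean_avgOutcome_sub hC hO hc₃ h_compact hmem hπ h_eq h_nhds
  simpa only [integral_q, ← hq, sub_add_sub_cancel] using
    h_lin.bigO.add (bigOInMean_expect_sub_integral memLp_q)

theorem Sampling.boundedInProbability_finiteValue :
    BoundedInProbability μ fun n ω =>
      √n * (M.finiteValue n π ω - M.continuumValue μ pstar π) := by
  have h_mean := (hM.bigOInMean_policyExp hπ (hM.bigOInMean_avgOutcome_sub_popY hC hO hc₃ h_compact
    hmem hπ h_eq h_nhds)).boundedInProbability <| by
      filter_upwards [eventually_gt_atTop 0] with n hn using by positivity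
  simpa only [← policyExp_sub_const, Real.rpow_neg (Nat.cast_nonneg _), div_inv_eq_mul,
    ← Real.sqrt_eq_rpow, finiteValue_eq_policyExp, continuumValue, mul_comm] using h_mean

end Regular

end Market

namespace Market

variable {Ω 𝓧 𝓑 : Type*} {J : ℕ} {M : Market Ω 𝓧 𝓑 J}

theorem finiteGTE_eq_sub (n : ℕ) (ω : Ω) :
    M.finiteGTE n ω = M.avgOutcome (M.bids n (fun _ => true) ω)
      - M.avgOutcome (M.bids n (fun _ => false) ω) := by
  rw [finiteGTE, Finset.sum_sub_distrib, mul_sub, one_div_mul_sum_outcome, one_div_mul_sum_outcome]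

variable [MeasurableSpace Ω] {μ : Measure Ω}

theorem popY_constRule (w : Bool) : M.popY μ (constRule 𝓧 w) = M.meanY μ w := by
  funext p
  cases w <;> simp [popY, meanY, constRule]

theorem popZ_constRule (w : Bool) :
    M.popZ μ (constRule 𝓧 w) = fun p => M.meanD μ w p - M.cap := by
  funext p
  cases w <;> simp [popZ, meanD, constRule]

theorem shadowPrice_constRule (w : Bool) (p : RJ J) :
    M.shadowPrice μ (constRule 𝓧 w) p = M.nu μ w p := by
  rw [shadowPrice, nu, popY_constRule, popZ_constRule, fderiv_sub_const]

theorem RegularEquilibrium.mem_nhds {Pol : Set (𝓧 → ℝ)} {pstar : (𝓧 → ℝ) → RJ J} {c' c₃ : ℝ}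
    (hE : M.RegularEquilibrium μ Pol pstar c' c₃) {π : 𝓧 → ℝ} (hπ : π ∈ Pol) :
    M.S ∈ 𝓝 (pstar π) := by
  obtain ⟨c₁, hc₁, h_ball⟩ := hE.interior
  exact Filter.mem_of_superset (Metric.ball_mem_nhds _ hc₁) (h_ball π hπ)

variable [MeasurableSpace 𝓧]

theorem Sampling.littleOInMean_avgOutcome_bids_sub_score [MeasurableSpace 𝓑]
    [IsProbabilityMeasure μ] {Pol : Set (𝓧 → ℝ)} {pstar : (𝓧 → ℝ) → RJ J} {c' c₃ c₄ : ℝ}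
    (hM : M.Sampling μ) (hC : M.CutoffMechanism μ Pol)
    (hO : M.RegularOutcomes μ Pol pstar c' c₃ c₄) (hc₃ : 0 < c₃) (h_compact : IsCompact M.S)
    (w : Bool) (hmem : constRule 𝓧 w ∈ Pol) (hw : IsTreatmentRule (constRule 𝓧 w))
    (h_eq : M.IsEquilibrium μ (constRule 𝓧 w) (pstar (constRule 𝓧 w)))
    (h_nhds : M.S ∈ 𝓝 (pstar (constRule 𝓧 w))) :
    LittleOInMean (fun _ => μ) (fun n ω => M.avgOutcome (M.bids n (fun _ => w) ω) -
      𝔼 i : Fin n, M.score μ w (pstar (constRule 𝓧 w)) (M.B w i ω) (pstar (constRule 𝓧 w)))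
      fun n => (n : ℝ) ^ (-(1 / 2) : ℝ) := by
  simpa only [policyExp_constRule, shadowPrice_constRule] using! hM.littleOInMean_policyExp hw
    (hM.littleOInMean_avgOutcome_sub hC hO hc₃ h_compact hmem hw h_eq h_nhds)

end Market

end CutoffMarket

end

open CutoffMarket in
theorem mainTheorem1_general {Ω 𝓧 𝓑 : Type*} [MeasurableSpace Ω] [MeasurableSpace 𝓧]
    [MeasurableSpace 𝓑] (μ : Measure Ω) [IsProbabilityMeasure μ] {J : ℕ} (M : Market Ω 𝓧 𝓑 J)
    (Pol : Set (𝓧 → ℝ))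
    (hPol : ∀ π ∈ Pol, Measurable π ∧ ∀ x, π x ∈ Set.Icc (0 : ℝ) 1)
    (hPol_const : ∀ w : Bool, constRule 𝓧 w ∈ Pol)
    (pstar : (𝓧 → ℝ) → RJ J) (c' c₃ c₄ : ℝ) (hc₃ : 0 < c₃)
    (h_sampling : M.Sampling μ) (h_cutoff : M.CutoffMechanism μ Pol)
    (h_outcomes : M.RegularOutcomes μ Pol pstar c' c₃ c₄) (h_compact : IsCompact M.S)
    (h_equilibrium : ∀ π ∈ Pol, M.IsEquilibrium μ π (pstar π))
    (h_nhds : ∀ π ∈ Pol, M.S ∈ 𝓝 (pstar π)) :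
    (∀ π ∈ Pol, BoundedInProbability μ fun n ω =>
      √n * (M.finiteValue n π ω - M.continuumValue μ pstar π)) ∧
    LittleOInProbability μ
      (fun n ω => (M.finiteGTE n ω - M.continuumGTE μ pstar) -
        ((1 / (n : ℝ)) * ∑ i : Fin n,
            (M.score μ true (pstar (constRule 𝓧 true)) (M.B true i ω) (pstar (constRule 𝓧 true))
              - M.score μ false (pstar (constRule 𝓧 false)) (M.B false i ω)
                (pstar (constRule 𝓧 false)))
          - M.continuumGTE μ pstar))
      (fun n => (n : ℝ) ^ (-(1 / 2) : ℝ)) := by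
  have h_rule {π : 𝓧 → ℝ} (hπ : π ∈ Pol) : IsTreatmentRule π := ⟨(hPol π hπ).1, (hPol π hπ).2⟩
  refine ⟨fun π hπ => h_sampling.boundedInProbability_finiteValue h_cutoff h_outcomes hc₃ h_compact
    hπ (h_rule hπ) (h_equilibrium π hπ) (h_nhds π hπ), ?_⟩
  have h_arm (w : Bool) := h_sampling.littleOInMean_avgOutcome_bids_sub_score h_cutoff h_outcomes
    hc₃ h_compact w (hPol_const w) (h_rule (hPol_const w)) (h_equilibrium _ (hPol_const w))
    (h_nhds _ (hPol_const w))
  have h_pos : ∀ᶠ n : ℕ in atTop, 0 < (n : ℝ) ^ (-(1 / 2) : ℝ) := by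
    filter_upwards [eventually_gt_atTop 0] with n hn using by positivity
  convert ((h_arm true).sub (h_arm false)).littleOInProbability h_pos using 3 with n ω
  rw [Market.finiteGTE_eq_sub, sub_sub_sub_cancel_right, ← smul_eq_mul, ← expect_eq_smul_sum,
    Finset.expect_sub_distrib, sub_sub_sub_comm]

theorem mainTheorem1 {Ω 𝓧 𝓑 : Type*} [MeasurableSpace Ω] [MeasurableSpace 𝓧]
    [MeasurableSpace 𝓑] (μ : Measure Ω) [IsProbabilityMeasure μ] {J : ℕ} (hJ : 0 < J)
    (M : CutoffMarket.Market Ω 𝓧 𝓑 J)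
    (Pol : Set (𝓧 → ℝ))
    (hPol : ∀ π ∈ Pol, Measurable π ∧ ∀ x, π x ∈ Set.Icc (0 : ℝ) 1)
    (hPol_const : ∀ w : Bool, CutoffMarket.constRule 𝓧 w ∈ Pol)
    (pstar : (𝓧 → ℝ) → CutoffMarket.RJ J)
    (c' c₃ c₄ : ℝ) (hc' : 0 < c') (hc₃ : 0 < c₃)
    (h_sampling : M.Sampling μ)
    (h_identification : M.Identification μ)
    (h_cutoff : M.CutoffMechanism μ Pol)
    (h_outcomes : M.RegularOutcomes μ Pol pstar c' c₃ c₄)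
    (h_equilibrium : M.RegularEquilibrium μ Pol pstar c' c₃) :
    (∀ π ∈ Pol, CutoffMarket.BoundedInProbability μ fun n ω =>
      Real.sqrt n * (M.finiteValue n π ω - M.continuumValue μ pstar π)) ∧
    CutoffMarket.LittleOInProbability μ
      (fun n ω =>
        (M.finiteGTE n ω - M.continuumGTE μ pstar) -
          ((1 / (n : ℝ)) * ∑ i : Fin n,
              (M.score μ true (pstar (CutoffMarket.constRule 𝓧 true))
                  (M.B true i ω) (pstar (CutoffMarket.constRule 𝓧 true))
                - M.score μ false (pstar (CutoffMarket.constRule 𝓧 false))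
                  (M.B false i ω) (pstar (CutoffMarket.constRule 𝓧 false)))
            - M.continuumGTE μ pstar))
      (fun n => (n : ℝ) ^ (-(1 / 2) : ℝ)) := by
  exact mainTheorem1_general μ M Pol hPol hPol_const pstar c' c₃ c₄ hc₃ h_sampling h_cutoff
    h_outcomes h_equilibrium.compact h_equilibrium.equilibrium fun _ => h_equilibrium.mem_nhds
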